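/- Let $X=(X_t)_{t\ge 0}$ be a spectrally positive L\'evy process, i.e. a real-valued L\'evy process with only positive jumps (the absence of jumps being allowed) that is not a subordinator with drift. Assume that $X$ is of unbounded variation, and let $\varphi$ be its Laplace exponent, $\mathbb{E}e^{-\lambda X_t}=e^{t\varphi(\lambda)}$ for $t,\lambda\ge 0$. Suppose that there are $\alpha>0$, $c\in(0,1]$ and $x_0\ge 0$ such that \[ \varphi''(\lambda x)\ \ge\ c\,\lambda^{\alpha-2}\,\varphi''(x)\qquad\text{for all }\lambda\ge 1 \text{ and } x>x_0 . \] Then for every $t>0$ the law of $X_t$ is absolutely continuous with respect to Lebesgue measure, and it has a continuous density $p(t,\cdot)$. Moreover, for each $\varepsilon>0$ there is $M_0>0$ such that \[ \Big| p\big(t,-t\varphi'(w)\big)\,\sqrt{2\pi t\varphi''(w)}\,\exp\big\{t\big(w\varphi'(w)-\varphi(w)\big)\big\}-1\Big|\ \le\ \varepsilon \] for all $t>0$ and $w>x_0$ with $t w^2\varphi''(w)>M_0$. -/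

import Mathlib

open MeasureTheory ProbabilityTheory Filter Topology
open scoped NNReal

/-- A real-valued Lévy process `X = (X_t : t ≥ 0)` on a probability space `(Ω, P)`: it starts from
`0`, has independent and stationary increments, and almost all of its paths are right-continuous
with left limits (stochastic continuity follows from these properties). -/
structure IsLevyProcess {Ω : Type*} [MeasurableSpace Ω] (P : Measure Ω) (X : ℝ≥0 → Ω → ℝ) :
    Prop where
  measurable : ∀ t, Measurable (X t)
  start_zero : ∀ᵐ ω ∂P, X 0 ω = 0
  indep_increments : HasIndepIncrements X P
  stationary_increments : ∀ s t, IdentDistrib (fun ω => X (s + t) ω - X s ω) (X t) P P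
  right_continuous : ∀ᵐ ω ∂P, ∀ t, ContinuousWithinAt (fun s => X s ω) (Set.Ici t) t
  left_limits : ∀ᵐ ω ∂P, ∀ t, 0 < t → ∃ l, Tendsto (fun s => X s ω) (𝓝[<] t) (𝓝 l)

/-- The process has only positive jumps: almost surely, at every time `t > 0` the jump
`X_t - X_{t-}` is nonnegative. -/
def HasOnlyPositiveJumps {Ω : Type*} [MeasurableSpace Ω] (P : Measure Ω) (X : ℝ≥0 → Ω → ℝ) :
    Prop :=
  ∀ᵐ ω ∂P, ∀ t, 0 < t → ∀ l, Tendsto (fun s => X s ω) (𝓝[<] t) (𝓝 l) → l ≤ X t ω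

/-- Almost all paths have bounded variation on every compact time interval. -/
def HasBoundedVariationPaths {Ω : Type*} [MeasurableSpace Ω] (P : Measure Ω)
    (X : ℝ≥0 → Ω → ℝ) : Prop :=
  ∀ᵐ ω ∂P, LocallyBoundedVariationOn (fun t => X t ω) Set.univ

/-- A spectrally positive Lévy process of unbounded variation. A subordinator with drift has paths
of bounded variation, hence is excluded. -/
structure IsSpectrallyPositiveOfUnboundedVariation {Ω : Type*} [MeasurableSpace Ω]
    (P : Measure Ω) (X : ℝ≥0 → Ω → ℝ) : Prop where
  levy : IsLevyProcess P X
  only_positive_jumps : HasOnlyPositiveJumps P X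
  unbounded_variation : ¬ HasBoundedVariationPaths P X

/-- The Laplace exponent `φ(λ) = log E exp(-λ X_1)`, `λ ≥ 0`. For a Lévy process with only positive
jumps the expectation is finite for all `λ ≥ 0`, and `E exp(-λ X_t) = exp(t φ(λ))` for `t ≥ 0`. -/
noncomputable def laplaceExponent {Ω : Type*} [MeasurableSpace Ω] (P : Measure Ω)
    (X : ℝ≥0 → Ω → ℝ) (l : ℝ) : ℝ :=
  Real.log (∫ ω, Real.exp (-l * X 1 ω) ∂P)

/-- The weak lower scaling condition at infinity with index `a`, constant `c` and threshold `x₀`: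
`f (r x) ≥ c r ^ a f(x)` for all `r ≥ 1` and `x > x₀`. -/
def WeakLowerScaling (a c x₀ : ℝ) (f : ℝ → ℝ) : Prop :=
  ∀ r x : ℝ, 1 ≤ r → x₀ < x → c * r ^ a * f x ≤ f (r * x)

/-! Write E exp(-z X_t) = exp(t ψ(z)) on Re z ≥ 0. The density at x is (2π)⁻¹ ∫ exp((w+iu)x + t
ψ(w+iu)) du for any admissible vertical line, and for x = -tφ'(w) the line through w passes through
the saddle point. After the substitution u = v/√(tφ''(w)) the normalised integrand is close to
exp(-v²/2) when T = t w² φ''(w) is large.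

Two estimates make this uniform. The lower bound φ(w) - Re ψ(w+iu) ≥ κ u² max(1,|u|/w)^(min(α,2)-2)
φ''(w) (`exists_sub_re_exponent_ge`) gives, for T ≥ 1, an integrable majorant depending only on κ
and min(α,2). The Taylor bound with remainder of order |u|³ φ''(w/2)/w
(`norm_exponent_sub_taylor_le`), combined with φ''(w/2) ≤ D φ''(w)
(`WeakLowerScaling.exists_half_le`), gives a pointwise error of order |v|³/√T. Hence the total error
is bounded by a function of T alone that vanishes at infinity (`abs_density_mul_sub_one_le`,
`tendsto_integral_min_zero`).

The Lévy–Khintchine formula is not used. Its role is played by limits of n E f(X_{1/n})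
(`HasMeshLimit`): exp(-zy) - 1 gives ψ(z), y² exp(-wy) gives φ''(w), and pointwise inequalities
between test functions become inequalities between exponents. Positivity of the jumps enters as
P(X_{1/n} < -δ) = o(1/n) (`tendsto_mul_measureReal_lt`), which makes test functions on (-∞,-δ)
negligible, and through a Fatou argument that yields exponential moments
(`lintegral_exp_one_lt_top`). -/

/-! ### Fourier inversion for probability measures on the line. -/

section FourierInversion

open Complex FourierTransform

/-- The Gaussian regularisation of the inverse Fourier integral of a characteristic function is
the density of a convolution with a Gaussian law. -/
lemma integral_gaussian_mul_charFun (μ : Measure ℝ) [IsProbabilityMeasure μ] {b : ℝ} (hb : 0 < b)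
    (x : ℝ) :
    ∫ v : ℝ, cexp (-b * v ^ 2) * (cexp (-(2 * Real.pi * v * x) * I) * charFun μ (2 * Real.pi * v))
      = ((∫ y, Real.sqrt (Real.pi / b) * Real.exp (-(Real.pi ^ 2 / b) * (y - x) ^ 2) ∂μ : ℝ) : ℂ) := by
  have hbr : (0 : ℝ) < (b : ℂ).re := by simpa using hb
  have h1 : ∀ v : ℝ, cexp (-b * v ^ 2) *
      (cexp (-(2 * Real.pi * v * x) * I) * charFun μ (2 * Real.pi * v)) =
      ∫ y, cexp (I * (2 * Real.pi * (y - x) : ℂ) * v) * cexp (-b * v ^ 2) ∂μ := by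
    intro v
    rw [charFun_apply_real, ← integral_const_mul, ← integral_const_mul]
    congr 1; ext y
    rw [← Complex.exp_add, ← Complex.exp_add, ← Complex.exp_add]
    congr 1; push_cast; ring
  simp_rw [h1]
  rw [integral_integral_swap]
  · simp_rw [fourierIntegral_gaussian hbr]
    rw [← integral_complex_ofReal]
    congr 1; ext y
    rw [ofReal_mul, Real.sqrt_eq_rpow, ofReal_cpow (by positivity), ofReal_exp]
    push_cast
    congr 2
    have : (b : ℂ) ≠ 0 := by exact_mod_cast hb.ne'
    field_simp
    ring
  · have hg : Integrable (fun z : ℝ × ℝ => cexp (-b * (z.1 : ℂ) ^ 2)) (volume.prod μ) := by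
      simpa using (integrable_cexp_neg_mul_sq hbr).mul_prod (integrable_const (1 : ℂ) (μ := μ))
    refine Integrable.mono hg (Continuous.aestronglyMeasurable (by fun_prop)) (ae_of_all _ ?_)
    rintro ⟨v, y⟩
    simp only [Function.uncurry, norm_mul]
    rw [show I * (2 * Real.pi * ((y : ℂ) - x)) * v = ((2 * Real.pi * (y - x) * v : ℝ) : ℂ) * I by
      push_cast; ring, Complex.norm_exp_ofReal_mul_I, one_mul]

/-- A probability measure on the line with integrable characteristic function has a continuous
density, given by the inversion formula. -/
theorem exists_density_of_integrable_charFun (μ : Measure ℝ) [IsProbabilityMeasure μ]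
    (hint : Integrable (charFun μ)) :
    ∃ q : ℝ → ℝ, Continuous q ∧ (∀ x, 0 ≤ q x) ∧
      μ = volume.withDensity (fun x => ENNReal.ofReal (q x)) ∧
      ∀ x, (q x : ℂ) = (1 / (2 * Real.pi)) * ∫ u : ℝ, cexp (-(u * x) * I) * charFun μ u := by
  set g : ℝ → ℂ := fun v => charFun μ (2 * Real.pi * v) with hg
  have hpi : (2 * Real.pi) ≠ 0 := by positivity
  have hgint : Integrable g := hint.comp_mul_left' hpi
  have hgc : Continuous g := (continuous_charFun).comp (by fun_prop)
  have hF : ∀ x : ℝ, 𝓕 g x = ∫ v : ℝ, cexp (-(2 * Real.pi * v * x) * I) * g v := by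
    intro x
    rw [Real.fourier_real_eq_integral_exp_smul]
    congr 1; ext v
    rw [smul_eq_mul]; push_cast; ring_nf
  have hnorm : ∀ x v : ℝ, ‖cexp (-(2 * Real.pi * v * x) * I) * g v‖ = ‖g v‖ := by
    intro x v
    rw [norm_mul, show (-(2 * Real.pi * v * x) * I : ℂ) = ((-(2 * Real.pi * v * x) : ℝ) : ℂ) * I by
      push_cast; ring, Complex.norm_exp_ofReal_mul_I, one_mul]
  have hFc : Continuous (𝓕 g) := by
    rw [funext hF]
    refine continuous_of_dominated (bound := fun v => ‖g v‖) ?_ ?_ hgint.norm ?_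
    · intro x; exact Continuous.aestronglyMeasurable (by fun_prop)
    · intro x; exact ae_of_all _ fun v => (hnorm x v).le
    · exact ae_of_all _ fun v => by fun_prop
  -- Densities of Gaussian smoothings of μ. Their pointwise limit is the inverse transform, which is
  -- therefore real and nonnegative.
  set G : ℕ → ℝ → ℝ := fun n x => ∫ y, Real.sqrt (Real.pi / ((n : ℝ) + 1)⁻¹) *
    Real.exp (-(Real.pi ^ 2 / ((n : ℝ) + 1)⁻¹) * (y - x) ^ 2) ∂μ with hG
  have hlim : ∀ x, Tendsto (fun n => ((G n x : ℝ) : ℂ)) atTop (𝓝 (𝓕 g x)) := by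
    intro x
    have h0 : Integrable (fun v : ℝ => cexp (-(2 * Real.pi * v * x) * I) * g v) :=
      hgint.mono (Continuous.aestronglyMeasurable (by fun_prop))
        (ae_of_all _ fun v => (hnorm x v).le)
    have h1 := (Real.tendsto_integral_cexp_sq_smul h0).comp
      (tendsto_atTop_add_const_right atTop (1 : ℝ) tendsto_natCast_atTop_atTop)
    rw [← hF] at h1
    refine h1.congr fun n => ?_
    have hb : (0 : ℝ) < ((n : ℝ) + 1)⁻¹ := by positivity
    rw [hG]
    simp only
    rw [← integral_gaussian_mul_charFun μ hb x]
    simp only [Function.comp]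
    congr 1; ext v
    rw [smul_eq_mul, Real.norm_eq_abs, ← ofReal_pow, ← ofReal_pow, sq_abs]
  have hG0 : ∀ n x, 0 ≤ G n x := fun n x => integral_nonneg fun y => by positivity
  have hre : ∀ x, Tendsto (fun n => G n x) atTop (𝓝 (𝓕 g x).re) := fun x => by
    simpa [Function.comp_def] using (Complex.continuous_re.tendsto _).comp (hlim x)
  have him : ∀ x, (𝓕 g x).im = 0 := fun x => by
    have := (Complex.continuous_im.tendsto _).comp (hlim x)
    exact tendsto_nhds_unique this (by simp [Function.comp_def])
  have hq : ∀ x, (((𝓕 g x).re : ℝ) : ℂ) = 𝓕 g x := fun x => Complex.ext (by simp) (by simp [him])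
  have hq0 : ∀ x, 0 ≤ (𝓕 g x).re := fun x => ge_of_tendsto' (hre x) fun n => hG0 n x
  have hqc : Continuous fun x => (𝓕 g x).re := by fun_prop
  have hGi : ∀ n, ∫⁻ x, ENNReal.ofReal (G n x) = 1 := by
    intro n
    have hb : (0 : ℝ) < ((n : ℝ) + 1)⁻¹ := by positivity
    set b := ((n : ℝ) + 1)⁻¹ with hbdef
    have hint' : ∀ x, Integrable (fun y => Real.sqrt (Real.pi / b) *
        Real.exp (-(Real.pi ^ 2 / b) * (y - x) ^ 2)) μ := by
      intro x
      refine Integrable.mono' (integrable_const (Real.sqrt (Real.pi / b)))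
        (Continuous.aestronglyMeasurable (by fun_prop)) (ae_of_all _ fun y => ?_)
      rw [Real.norm_of_nonneg (by positivity)]
      refine mul_le_of_le_one_right (by positivity) (Real.exp_le_one_iff.2 ?_)
      have : 0 ≤ Real.pi ^ 2 / b * (y - x) ^ 2 := by positivity
      linarith
    have h1 : ∀ x, ENNReal.ofReal (G n x) = ∫⁻ y, ENNReal.ofReal (Real.sqrt (Real.pi / b) *
        Real.exp (-(Real.pi ^ 2 / b) * (y - x) ^ 2)) ∂μ := fun x =>
      ofReal_integral_eq_lintegral_ofReal (hint' x) (ae_of_all _ fun y => by positivity)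
    simp_rw [h1]
    rw [lintegral_lintegral_swap (by
      refine Measurable.aemeasurable ?_
      simp only [Function.uncurry_def]; fun_prop)]
    have h2 : ∀ y : ℝ, ∫⁻ x, ENNReal.ofReal (Real.sqrt (Real.pi / b) *
        Real.exp (-(Real.pi ^ 2 / b) * (y - x) ^ 2)) = 1 := by
      intro y
      have hpb : 0 < Real.pi ^ 2 / b := by positivity
      have hi : Integrable (fun x : ℝ => Real.exp (-(Real.pi ^ 2 / b) * (y - x) ^ 2)) :=
        (integrable_exp_neg_mul_sq hpb).comp_sub_left y
      rw [← ofReal_integral_eq_lintegral_ofReal (hi.const_mul _)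
        (ae_of_all _ fun x => by positivity), integral_const_mul,
        integral_sub_left_eq_self (fun x => Real.exp (-(Real.pi ^ 2 / b) * x ^ 2)),
        integral_gaussian, ← Real.sqrt_mul (by positivity)]
      rw [show Real.pi / b * (Real.pi / (Real.pi ^ 2 / b)) = 1 by
        have := Real.pi_pos.ne'
        field_simp]
      simp
    calc _ = ∫⁻ y, 1 ∂μ := lintegral_congr h2
      _ = 1 := by simp
  -- Fatou makes the limit integrable, which is what Fourier inversion needs in order to recover the
  -- characteristic function.
  have hqi : ∫⁻ x, ENNReal.ofReal (𝓕 g x).re ≤ 1 := by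
    have hl : ∀ x, ENNReal.ofReal (𝓕 g x).re =
        liminf (fun n => ENNReal.ofReal (G n x)) atTop := fun x =>
      ((ENNReal.continuous_ofReal.tendsto _).comp (hre x)).liminf_eq.symm
    simp_rw [hl]
    refine (lintegral_liminf_le' fun n => ?_).trans ?_
    · refine Measurable.aemeasurable (ENNReal.measurable_ofReal.comp ?_)
      refine StronglyMeasurable.measurable ?_
      refine StronglyMeasurable.integral_prod_right (f := fun x y =>
        Real.sqrt (Real.pi / ((n : ℝ) + 1)⁻¹) *
        Real.exp (-(Real.pi ^ 2 / ((n : ℝ) + 1)⁻¹) * (y - x) ^ 2)) ?_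
      exact Continuous.stronglyMeasurable (by simp only [Function.uncurry_def]; fun_prop)
    · simp [hGi]
  have hFi : Integrable (fun x => (𝓕 g x).re) := by
    refine ⟨hqc.aestronglyMeasurable, ?_⟩
    rw [hasFiniteIntegral_iff_ofReal (ae_of_all _ hq0)]
    exact hqi.trans_lt ENNReal.one_lt_top
  have hFi' : Integrable (𝓕 g) := by
    have := hFi.ofReal (𝕜 := ℂ)
    refine this.congr (ae_of_all _ fun x => hq x)
  have hinv := hgc.fourierInv_fourier_eq hgint hFi'
  refine ⟨fun x => (𝓕 g x).re, hqc, hq0, ?_, fun x => ?_⟩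
  · have : IsFiniteMeasure (volume.withDensity fun x => ENNReal.ofReal (𝓕 g x).re) :=
      isFiniteMeasure_withDensity_ofReal hFi.2
    refine Measure.ext_of_charFun ?_
    ext u
    have h1 : charFun μ u = g (u / (2 * Real.pi)) := by
      rw [hg]; simp only; congr 1; field_simp
    rw [h1, ← congrFun hinv, Real.fourierInv_eq', charFun_apply_real,
      integral_withDensity_eq_integral_toReal_smul (by fun_prop) (by simp)]
    congr 1; ext x
    rw [ENNReal.toReal_ofReal (hq0 x), smul_eq_mul, Complex.real_smul, hq, mul_comm]
    congr 2
    simp only [RCLike.inner_apply, conj_trivial]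
    push_cast
    have : (Real.pi : ℂ) ≠ 0 := by exact_mod_cast Real.pi_pos.ne'
    field_simp
  · rw [hq, hF]
    have := Measure.integral_comp_mul_left (fun u : ℝ => cexp (-(u * x) * I) * charFun μ u)
      (2 * Real.pi)
    rw [abs_of_pos (by positivity), Complex.real_smul] at this
    simp only [hg]
    push_cast at this ⊢
    rw [one_div, ← this]

end FourierInversion

/-! ### Multiplicative and additive functions on the half-line, and paths without negative jumps. -/

section Semigroups

/-- With truncated subtraction, f s · f(t - s) = f t · f(s - t) whichever of s, t is larger; both
increments tend to 0 as s → t, so one formula treats both sides. -/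
lemma NNReal.continuous_of_map_add_eq_mul {f : ℝ≥0 → ℂ} (h0 : f 0 = 1)
    (hmul : ∀ s t, f (s + t) = f s * f t) (hc : ContinuousAt f 0) : Continuous f := by
  have h0' : Tendsto f (𝓝 0) (𝓝 1) := h0 ▸ hc
  rw [continuous_iff_continuousAt]
  intro t
  have h1 : Tendsto (fun s => f (s - t)) (𝓝 t) (𝓝 1) := by
    refine h0'.comp ?_
    have : Continuous fun s : ℝ≥0 => s - t := by fun_prop
    simpa using this.tendsto t
  have h2 : Tendsto (fun s => f (t - s)) (𝓝 t) (𝓝 1) := by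
    refine h0'.comp ?_
    have : Continuous fun s : ℝ≥0 => t - s := by fun_prop
    simpa using this.tendsto t
  have h3 : Tendsto (fun s => f t * f (s - t) / f (t - s)) (𝓝 t) (𝓝 (f t)) := by
    simpa [Pi.div_def] using (h1.const_mul (f t)).div h2 one_ne_zero
  refine h3.congr' ?_
  filter_upwards [h2.eventually_ne one_ne_zero] with s hs
  rw [div_eq_iff hs, ← hmul, ← hmul]
  congr 1
  rcases le_total s t with h | h
  · simp [h, tsub_eq_zero_of_le h]
  · simp [h, tsub_eq_zero_of_le h]

/-- A multiplicative function on the half-line, continuous at the origin, is an exponential. -/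
theorem NNReal.exists_eq_cexp_of_map_add_eq_mul {f : ℝ≥0 → ℂ} (h0 : f 0 = 1)
    (hmul : ∀ s t, f (s + t) = f s * f t) (hc : ContinuousAt f 0) :
    ∃ ψ : ℂ, ∀ t : ℝ≥0, f t = Complex.exp (t * ψ) := by
  have hcont := NNReal.continuous_of_map_add_eq_mul h0 hmul hc
  set F : ℝ → ℂ := fun t => f t.toNNReal with hF
  have hFc : Continuous F := hcont.comp continuous_real_toNNReal
  have hF0 : F 0 = 1 := by simp [hF, h0]
  have hFmul : ∀ s t, 0 ≤ s → 0 ≤ t → F (s + t) = F s * F t := fun s t hs ht => by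
    simp only [hF, Real.toNNReal_add hs ht, hmul]
  set I : ℝ → ℂ := fun x => ∫ s in (0 : ℝ)..x, F s with hI
  have hId : ∀ x, HasDerivAt I (F x) x := fun x => hFc.integral_hasStrictDerivAt 0 x |>.hasDerivAt
  obtain ⟨a, ha0, ha⟩ : ∃ a : ℝ, 0 < a ∧ I a ≠ 0 := by
    have h1 := (hId 0).eventually_ne (c := 0) (by rw [hF0]; exact one_ne_zero)
    have h2 : ∀ᶠ x in 𝓝[>] (0 : ℝ), I x ≠ 0 :=
      h1.filter_mono (nhdsWithin_mono _ fun x hx => (ne_of_gt hx))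
    obtain ⟨a, h3, h4⟩ := (h2.and self_mem_nhdsWithin).exists
    exact ⟨a, h4, h3⟩
  -- Averaging over [t, t+a] reproduces F by multiplicativity, and a primitive of a continuous
  -- function is differentiable; so F solves a linear differential equation.
  set E : ℝ → ℂ := fun t => (I (t + a) - I t) / I a with hE
  have hEF : ∀ t, 0 ≤ t → E t = F t := by
    intro t ht
    rw [hE]
    simp only
    rw [div_eq_iff ha]
    have h1 : I (t + a) - I t = ∫ s in t..(t + a), F s :=
      intervalIntegral.integral_interval_sub_left (hFc.intervalIntegrable _ _)
        (hFc.intervalIntegrable _ _)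
    have h2 : ∫ s in (0 : ℝ)..a, F (s + t) = ∫ s in t..(t + a), F s := by
      rw [intervalIntegral.integral_comp_add_right]; congr 1 <;> ring
    rw [h1, ← h2, hI]
    simp only
    rw [← intervalIntegral.integral_const_mul]
    refine intervalIntegral.integral_congr fun s hs => ?_
    rw [Set.uIcc_of_le ha0.le] at hs
    rw [add_comm s t, hFmul t s ht hs.1]
  set ψ := (F a - 1) / I a with hψ
  have hEd : ∀ t, 0 ≤ t → HasDerivAt E (ψ * E t) t := by
    intro t ht
    have h1 : HasDerivAt E ((F (t + a) - F t) / I a) t := by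
      have h2 : HasDerivAt (fun t => I (t + a)) (F (t + a)) t := by
        simpa using (hId (t + a)).comp_add_const t a
      exact (h2.sub (hId t)).div_const _
    convert h1 using 1
    rw [hEF t ht, hFmul t a ht ha0.le, hψ]; ring
  refine ⟨ψ, fun t => ?_⟩
  set H : ℝ → ℂ := fun t => E t * Complex.exp (-(t * ψ)) with hH
  have hHd : ∀ s, 0 ≤ s → HasDerivAt H 0 s := by
    intro s hs
    have h1 : HasDerivAt (fun s : ℝ => Complex.exp (-(s * ψ)))
        (Complex.exp (-(s * ψ)) * (-(1 * ψ))) s :=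
      ((Complex.ofRealCLM.hasDerivAt (x := s)).mul_const ψ).neg.cexp
    have h2 : HasDerivAt H _ s := (hEd s hs).mul h1
    rwa [show ψ * E s * Complex.exp (-(s * ψ)) +
      E s * (Complex.exp (-(s * ψ)) * -(1 * ψ)) = 0 by ring] at h2
  have hHc := constant_of_has_deriv_right_zero (f := H) (a := 0) (b := t)
    (fun s hs => (hHd s hs.1).continuousAt.continuousWithinAt)
    (fun s hs => (hHd s hs.1).hasDerivWithinAt) t ⟨t.2, le_rfl⟩
  have hH0 : H 0 = 1 := by simp [hH, hEF 0 le_rfl, hF0]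
  rw [hH0] at hHc
  have h5 : E t = f t := by rw [hEF t t.2]; simp [hF]
  rw [← h5]
  have h6 : E t * Complex.exp (-(t * ψ)) = 1 := hHc
  rw [Complex.exp_neg] at h6
  field_simp at h6
  exact h6

/-- An additive function on the half-line that is bounded below near the origin tends to zero
at the origin. -/
lemma NNReal.tendsto_zero_of_map_add {G : ℝ≥0 → ℝ} (hadd : ∀ s t, G (s + t) = G s + G t)
    {K : ℝ} (hK : ∀ᶠ t in 𝓝 0, -K ≤ G t) : Tendsto G (𝓝 0) (𝓝 0) := by
  have hG0 : G 0 = 0 := by simpa using hadd 0 0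
  have hn : ∀ (n : ℕ) t, G (n * t) = n * G t := by
    intro n t
    induction n with
    | zero => simp [hG0]
    | succ n ih => push_cast; rw [add_mul, one_mul, hadd, ih]; ring
  obtain ⟨η, hη, hη'⟩ := NNReal.nhds_zero_basis.eventually_iff.1 hK
  have hη2 : 0 < η / 2 := by positivity
  -- The upper bound comes from the lower bound at the complementary time η/2 - t. Boundedness then
  -- improves to smallness through G(nt) = n G(t).
  have hbd : ∃ C, ∀ t ≤ η / 2, |G t| ≤ C := by
    refine ⟨|K| + |G (η / 2)| , fun t ht => ?_⟩
    have hlt : η / 2 < η := NNReal.half_lt_self hη.ne'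
    have h1 := hη' (show t ∈ Set.Iio η from ht.trans_lt hlt)
    have h2 := hη' (show η / 2 - t ∈ Set.Iio η from tsub_le_self.trans_lt hlt)
    have h3 := hadd t (η / 2 - t)
    rw [add_tsub_cancel_of_le ht] at h3
    rw [abs_le]
    constructor <;>
      linarith [le_abs_self K, le_abs_self (G (η / 2)), abs_nonneg (G (η / 2))]
  obtain ⟨C, hC⟩ := hbd
  rw [Metric.tendsto_nhds]
  intro ε hε
  obtain ⟨n, hn'⟩ := exists_nat_gt (C / ε)
  have hC0 : 0 ≤ C := (abs_nonneg _).trans (hC 0 (by positivity))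
  have hnpos : 0 < (n : ℝ) := (div_nonneg hC0 hε.le).trans_lt hn'
  have hnpos' : (0 : ℝ≥0) < n := by exact_mod_cast hnpos
  filter_upwards [Iio_mem_nhds (show (0 : ℝ≥0) < η / 2 / n by positivity)] with t ht
  have h1 : (n : ℝ≥0) * t ≤ η / 2 := by
    rw [mul_comm]; exact ((lt_div_iff₀ hnpos').1 ht).le
  have h2 := hC _ h1
  rw [hn, abs_mul, abs_of_pos hnpos] at h2
  rw [Real.dist_eq, sub_zero]
  rw [div_lt_iff₀ hε] at hn'
  by_contra! h
  nlinarith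

/-- A càdlàg function without negative jumps has no large decrements over short intervals. -/
lemma exists_forall_sub_le_of_cadlag {x : ℝ≥0 → ℝ}
    (hr : ∀ t, ContinuousWithinAt x (Set.Ici t) t)
    (hl : ∀ t, 0 < t → ∃ l, Tendsto x (𝓝[<] t) (𝓝 l) ∧ l ≤ x t) {δ : ℝ} (hδ : 0 < δ) :
    ∃ ε > 0, ∀ s t : ℝ≥0, t ≤ 1 → s ≤ t → dist s t < ε → x s - δ ≤ x t := by
  have hloc : ∀ τ : ℝ≥0, ∃ U, IsOpen U ∧ τ ∈ U ∧ ∀ s ∈ U, ∀ t ∈ U, s ≤ t → x s - δ ≤ x t := by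
    intro τ
    obtain ⟨l, hl1, hl2⟩ : ∃ l, Tendsto x (𝓝[<] τ) (𝓝 l) ∧ l ≤ x τ := by
      rcases eq_or_ne τ 0 with rfl | h
      · refine ⟨x 0, ?_, le_rfl⟩
        simp
      · exact hl τ (pos_iff_ne_zero.2 h)
    have h1 : ∀ᶠ s in 𝓝[<] τ, |x s - l| < δ / 2 := by
      have := Metric.tendsto_nhds.1 hl1 (δ / 2) (by positivity)
      simpa [Real.dist_eq] using this
    have h2 : ∀ᶠ s in 𝓝[≥] τ, |x s - x τ| < δ / 2 := by
      have := Metric.tendsto_nhds.1 (hr τ) (δ / 2) (by positivity)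
      simpa [Real.dist_eq] using this
    rw [eventually_nhdsWithin_iff] at h1 h2
    obtain ⟨U, hU, hUo, hτ⟩ := eventually_nhds_iff.1 (h1.and h2)
    refine ⟨U, hUo, hτ, fun s hs t ht hst => ?_⟩
    obtain ⟨hs1, hs2⟩ := hU s hs
    obtain ⟨ht1, ht2⟩ := hU t ht
    rcases lt_or_ge t τ with h | h
    · have a := abs_lt.1 (ht1 h)
      have b := abs_lt.1 (hs1 (hst.trans_lt h))
      linarith [a.1, b.2]
    · have a := abs_lt.1 (ht2 h)
      rcases lt_or_ge s τ with h' | h'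
      · have b := abs_lt.1 (hs1 h')
        linarith [a.1, b.2]
      · have b := abs_lt.1 (hs2 h')
        linarith [a.1, b.2]
  choose U hUo hUm hU using hloc
  -- A Lebesgue number of the cover makes the local estimates uniform on [0,1].
  obtain ⟨ε, hε, h⟩ := lebesgue_number_lemma_of_metric (isCompact_Icc (a := (0 : ℝ≥0)) (b := 1))
    hUo (fun τ _ => Set.mem_iUnion.2 ⟨τ, hUm τ⟩)
  refine ⟨ε, hε, fun s t ht hst hd => ?_⟩
  obtain ⟨τ, hτ⟩ := h t ⟨zero_le, ht⟩
  exact hU τ s (hτ hd) t (hτ (Metric.mem_ball_self hε)) hst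

end Semigroups

/-! ### Increments over a mesh, and the negligibility of large negative ones. -/

section LevyProcess

variable {Ω : Type*} [MeasurableSpace Ω] {P : Measure Ω} {X : ℝ≥0 → Ω → ℝ}

namespace IsLevyProcess

lemma indepFun_increment (hX : IsLevyProcess P X) (s t : ℝ≥0) :
    IndepFun (X s) (fun ω => X (s + t) ω - X s ω) P :=
  hX.indep_increments.indepFun_eval_sub (r := 0) zero_le (by simp) hX.start_zero

lemma ae_tendsto_zero (hX : IsLevyProcess P X) :
    ∀ᵐ ω ∂P, Tendsto (fun t => X t ω) (𝓝 0) (𝓝 0) := by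
  filter_upwards [hX.start_zero, hX.right_continuous] with ω h0 hr
  have h : Set.Ici (0 : ℝ≥0) = Set.univ := by ext; simp
  have := hr 0
  rw [ContinuousWithinAt, h0, h, nhdsWithin_univ] at this
  exact this

/-- The extended-valued version applies to Laplace transforms before they are known to be finite. -/
lemma lintegral_comp_add (hX : IsLevyProcess P X) {F : ℝ → ENNReal} (hF : Measurable F)
    (hmul : ∀ x y, F (x + y) = F x * F y) (s t : ℝ≥0) :
    ∫⁻ ω, F (X (s + t) ω) ∂P = (∫⁻ ω, F (X s ω) ∂P) * ∫⁻ ω, F (X t ω) ∂P := by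
  have h1 : ∫⁻ ω, F (X t ω) ∂P = ∫⁻ ω, F (X (s + t) ω - X s ω) ∂P :=
    ((hX.stationary_increments s t).comp hF).lintegral_eq.symm
  have hm := hX.measurable
  have h2 := lintegral_mul_eq_lintegral_mul_lintegral_of_indepFun''
    (hF.comp (hm s)).aemeasurable (hF.comp ((hm (s + t)).sub (hm s))).aemeasurable
    ((hX.indepFun_increment s t).comp hF hF)
  simp only [Function.comp, Pi.sub_apply] at h2
  rw [h1, ← h2]
  refine lintegral_congr fun ω => ?_
  rw [← hmul]; congr 1; ring

lemma integral_comp_add (hX : IsLevyProcess P X) {F : ℝ → ℂ} (hF : Measurable F)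
    (hmul : ∀ x y, F (x + y) = F x * F y) (s t : ℝ≥0) :
    ∫ ω, F (X (s + t) ω) ∂P = (∫ ω, F (X s ω) ∂P) * ∫ ω, F (X t ω) ∂P := by
  have h1 : ∫ ω, F (X t ω) ∂P = ∫ ω, F (X (s + t) ω - X s ω) ∂P :=
    ((hX.stationary_increments s t).comp hF).integral_eq.symm
  have hm := hX.measurable
  have h2 := ((hX.indepFun_increment s t).comp hF hF).integral_fun_mul_eq_mul_integral
    (hF.comp (hm s)).aestronglyMeasurable
    (hF.comp ((hm (s + t)).sub (hm s))).aestronglyMeasurable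
  simp only [Function.comp] at h2
  rw [h1, ← h2]
  congr 1; ext ω
  rw [← hmul]; congr 1; ring

/-- The partition of the unit interval into `n + 1` equal pieces. -/
lemma monotone_mesh (n : ℕ) : Monotone fun k : ℕ => (k : ℝ≥0) / (n + 1) := by
  intro a b h
  have : (a : ℝ≥0) ≤ b := by exact_mod_cast h
  dsimp only
  gcongr

lemma identDistrib_mesh (hX : IsLevyProcess P X) (n k : ℕ) :
    IdentDistrib (fun ω => X (((k + 1 : ℕ) : ℝ≥0) / (n + 1)) ω - X ((k : ℝ≥0) / (n + 1)) ω)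
      (X (1 / (n + 1))) P P := by
  have := hX.stationary_increments ((k : ℝ≥0) / (n + 1)) (1 / (n + 1))
  rwa [← add_div, show (k : ℝ≥0) + 1 = ((k + 1 : ℕ) : ℝ≥0) by push_cast; rfl] at this

lemma iIndepFun_mesh (hX : IsLevyProcess P X) (n : ℕ) :
    iIndepFun (fun k : ℕ => fun ω =>
      X (((k + 1 : ℕ) : ℝ≥0) / (n + 1)) ω - X ((k : ℝ≥0) / (n + 1)) ω) P :=
  hX.indep_increments.nat (monotone_mesh n)

lemma measurable_mesh (hX : IsLevyProcess P X) (n k : ℕ) :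
    Measurable (fun ω => X (((k + 1 : ℕ) : ℝ≥0) / (n + 1)) ω - X ((k : ℝ≥0) / (n + 1)) ω) :=
  (hX.measurable _).sub (hX.measurable _)

/-- Almost surely, eventually no increment over the mesh is below `-δ`. -/
lemma ae_eventually_mesh (hX : IsLevyProcess P X) (hpos : HasOnlyPositiveJumps P X) {δ : ℝ}
    (hδ : 0 < δ) : ∀ᵐ ω ∂P, ∀ᶠ n : ℕ in atTop, ∀ k ∈ Finset.range (n + 1),
      -δ ≤ X (((k + 1 : ℕ) : ℝ≥0) / (n + 1)) ω - X ((k : ℝ≥0) / (n + 1)) ω := by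
  filter_upwards [hX.right_continuous, hX.left_limits, hpos] with ω h1 h2 h3
  obtain ⟨ε, hε, h⟩ := exists_forall_sub_le_of_cadlag h1
    (fun t ht => by obtain ⟨l, hl⟩ := h2 t ht; exact ⟨l, hl, h3 t ht l hl⟩) hδ
  have hlim := tendsto_one_div_add_atTop_nhds_zero_nat (𝕜 := ℝ)
  filter_upwards [hlim.eventually_lt_const hε] with n hn k hk
  have := h ((k : ℝ≥0) / (n + 1)) (((k + 1 : ℕ) : ℝ≥0) / (n + 1)) ?_
    (monotone_mesh n (Nat.le_succ k)) ?_
  · linarith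
  · rw [div_le_one (by positivity)]
    have := Finset.mem_range.1 hk
    exact_mod_cast this
  · rw [NNReal.dist_eq]
    push_cast
    rw [← sub_div, show (k : ℝ) - (k + 1) = -1 by ring, abs_div, abs_neg, abs_one,
      abs_of_pos (by positivity)]
    exact hn

variable [IsProbabilityMeasure P]

/-- The jump measure does not charge the negative half-line. -/
lemma tendsto_mul_measureReal_lt (hX : IsLevyProcess P X) (hpos : HasOnlyPositiveJumps P X) {δ : ℝ}
    (hδ : 0 < δ) : Tendsto (fun n : ℕ => ((n : ℝ) + 1) * P.real {ω | X (1 / (n + 1)) ω < -δ}) atTop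
      (𝓝 0) := by
  set A : ℕ → Set Ω := fun n => ⋂ k ∈ Finset.range (n + 1), (fun ω =>
    X (((k + 1 : ℕ) : ℝ≥0) / (n + 1)) ω - X ((k : ℝ≥0) / (n + 1)) ω) ⁻¹' Set.Ici (-δ) with hA
  have hAm : ∀ n, MeasurableSet (A n) := fun n =>
    Finset.measurableSet_biInter _ fun k _ => hX.measurable_mesh n k measurableSet_Ici
  have hA1 : Tendsto (fun n => P.real (A n)) atTop (𝓝 1) := by
    have := tendsto_measure_of_ae_tendsto_indicator_of_isFiniteMeasure (A := Set.univ) (As := A)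
      (μ := P) atTop MeasurableSet.univ hAm (by
        filter_upwards [hX.ae_eventually_mesh hpos hδ] with ω hω
        filter_upwards [hω] with n hn
        simpa [hA] using hn)
    rw [measure_univ] at this
    simpa [Measure.real, Function.comp_def] using (ENNReal.tendsto_toReal ENNReal.one_ne_top).comp this
  -- The mesh increments are i.i.d., so this probability is at most exp(-(n+1)p). Since it tends to
  -- 1, (n+1)p tends to 0.
  have hAp : ∀ n, P.real (A n) = (1 - P.real {ω | X (1 / (n + 1)) ω < -δ}) ^ (n + 1) := by
    intro n
    have h1 := (hX.iIndepFun_mesh n).measure_inter_preimage_eq_mul (Finset.range (n + 1))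
      (sets := fun _ => Set.Ici (-δ)) (fun _ _ => measurableSet_Ici)
    have h2 : ∀ k : ℕ, P ((fun ω => X (((k + 1 : ℕ) : ℝ≥0) / (n + 1)) ω -
        X ((k : ℝ≥0) / (n + 1)) ω) ⁻¹' Set.Ici (-δ)) = P {ω | X (1 / (n + 1)) ω < -δ}ᶜ := by
      intro k
      rw [(hX.identDistrib_mesh n k).measure_mem_eq measurableSet_Ici]
      congr 1; ext ω; simp
    simp only [h2, Finset.prod_const, Finset.card_range] at h1
    rw [Measure.real, hA]
    simp only
    rw [h1, ENNReal.toReal_pow, ← Measure.real, probReal_compl_eq_one_sub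
      (measurableSet_lt (hX.measurable _) measurable_const)]
  have hlog : Tendsto (fun n => -Real.log (P.real (A n))) atTop (𝓝 0) := by
    have := (hA1.log one_ne_zero).neg
    simpa using this
  refine tendsto_of_tendsto_of_tendsto_of_le_of_le' tendsto_const_nhds hlog
    (Eventually.of_forall fun n => by positivity) ?_
  filter_upwards [hA1.eventually (lt_mem_nhds one_pos)] with n hn
  set p := P.real {ω | X (1 / (n + 1)) ω < -δ} with hp
  have hp1 : p ≤ 1 := measureReal_le_one
  have h1 : P.real (A n) ≤ Real.exp (-(((n : ℝ) + 1) * p)) := by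
    rw [hAp n, ← hp]
    have h2 : (1 - p) ≤ Real.exp (-p) := by linarith [Real.add_one_le_exp (-p)]
    calc (1 - p) ^ (n + 1) ≤ Real.exp (-p) ^ (n + 1) := by
          gcongr
      _ = _ := by rw [← Real.exp_nat_mul]; congr 1; push_cast; ring
  have h2 := Real.log_le_log hn h1
  rw [Real.log_exp] at h2
  linarith

lemma norm_cexp_mul_I (x : ℝ) : ‖Complex.exp (-(x * Complex.I))‖ = 1 := by
  rw [show -((x : ℂ) * Complex.I) = ((-x : ℝ) : ℂ) * Complex.I by push_cast; ring]
  exact Complex.norm_exp_ofReal_mul_I _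

lemma exists_charFun_eq_cexp (hX : IsLevyProcess P X) (u : ℝ) :
    ∃ ψ : ℂ, ∀ t : ℝ≥0, ∫ ω, Complex.exp (-((u * X t ω : ℝ) * Complex.I)) ∂P =
      Complex.exp (t * ψ) := by
  have hm := hX.measurable
  refine NNReal.exists_eq_cexp_of_map_add_eq_mul ?_ (fun s t => ?_) ?_
  · have : (fun ω => Complex.exp (-((u * X 0 ω : ℝ) * Complex.I))) =ᵐ[P] fun _ => 1 := by
      filter_upwards [hX.start_zero] with ω h
      simp [h]
    rw [integral_congr_ae this]; simp
  · refine hX.integral_comp_add (F := fun x : ℝ => Complex.exp (-((u * x : ℝ) * Complex.I)))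
      (by fun_prop) (fun x y => ?_) s t
    rw [← Complex.exp_add]; push_cast; congr 1; ring
  · refine tendsto_integral_filter_of_dominated_convergence (fun _ => 1)
      (Eventually.of_forall fun t => ?_) (Eventually.of_forall fun t => ae_of_all _ fun ω => ?_)
      (integrable_const _) ?_
    · have := hm t
      exact Measurable.aestronglyMeasurable (by fun_prop)
    · exact (norm_cexp_mul_I _).le
    · filter_upwards [hX.ae_tendsto_zero, hX.start_zero] with ω h h0
      rw [h0]
      have hc : Continuous fun x : ℝ => Complex.exp (-((u * x : ℝ) * Complex.I)) := by fun_prop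
      exact (hc.tendsto 0).comp h

end IsLevyProcess

/-- Along the mesh, an exponential semigroup has difference quotients converging to its
generator. -/
lemma tendsto_mul_cexp_sub_one (ψ : ℂ) :
    Tendsto (fun n : ℕ => ((n : ℂ) + 1) * (Complex.exp (((1 / (n + 1) : ℝ≥0) : ℂ) * ψ) - 1)) atTop
      (𝓝 ψ) := by
  have h1 : HasDerivAt (fun t : ℝ => Complex.exp ((t : ℂ) * ψ)) ψ 0 := by
    have := ((Complex.ofRealCLM.hasDerivAt (x := 0)).mul_const ψ).cexp
    simpa using this
  have h2 := h1.tendsto_slope_zero_right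
  have h3 : Tendsto (fun n : ℕ => (1 / ((n : ℝ) + 1))) atTop (𝓝[>] 0) := by
    rw [tendsto_nhdsWithin_iff]
    exact ⟨tendsto_one_div_add_atTop_nhds_zero_nat, Eventually.of_forall fun n => by
      simp only [Set.mem_Ioi]; positivity⟩
  refine (h2.comp h3).congr fun n => ?_
  simp

lemma sq_div_five_le_one_sub_cos {x : ℝ} (hx : |x| ≤ 1) : x ^ 2 / 5 ≤ 1 - Real.cos x := by
  have := Real.cos_le_one_sub_mul_cos_sq (x := x) (hx.trans (by linarith [Real.pi_gt_three]))
  have hpi : (1 : ℝ) / 5 ≤ 2 / Real.pi ^ 2 := by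
    rw [div_le_div_iff₀ (by norm_num) (by positivity)]
    nlinarith [Real.pi_lt_d2, Real.pi_pos]
  nlinarith [sq_nonneg x]

/-- This controls Laplace transforms of increments, truncated at -1, by characteristic functions,
which are known to be exponential in time. For |y| ≤ 1 the first-order terms agree and the quadratic
error is absorbed by 1 - cos y ≥ y²/5. For y > 1 the left side is at most -η, and l sin y is
absorbed by AM-GM using sin² y ≤ 2(1 - cos y). -/
lemma exists_forall_exp_sub_one_le {l : ℝ} (hl : 0 < l) :
    ∃ a : ℝ, 0 ≤ a ∧ ∀ y : ℝ, -1 ≤ y →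
      Real.exp (-(l * y)) - 1 ≤ a * (1 - Real.cos y) - l * Real.sin y := by
  set η := 1 - Real.exp (-l) with hη
  have hη0 : 0 < η := by
    have : Real.exp (-l) < 1 := Real.exp_lt_one_iff.2 (by linarith)
    linarith
  refine ⟨5 * (l ^ 2 * Real.exp l + l) + l ^ 2 / (2 * η), by positivity, fun y hy => ?_⟩
  have hc : 0 ≤ 1 - Real.cos y := by linarith [Real.cos_le_one y]
  have hη2 : 0 ≤ l ^ 2 / (2 * η) := by positivity
  rcases le_or_gt y 1 with h | h
  · have hy1 : |y| ≤ 1 := abs_le.2 ⟨hy, h⟩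
    have h1 : Real.exp (-(l * y)) - 1 + l * y ≤ l ^ 2 * y ^ 2 * Real.exp l := by
      have h2 := Complex.norm_exp_sub_sum_le_norm_mul_exp ((-(l * y) : ℝ) : ℂ) 2
      rw [Finset.sum_range_succ, Finset.sum_range_one] at h2
      have h3 : Complex.exp ((-(l * y) : ℝ) : ℂ) - (((-(l * y) : ℝ) : ℂ) ^ 0 / (Nat.factorial 0 : ℕ)
          + ((-(l * y) : ℝ) : ℂ) ^ 1 / (Nat.factorial 1 : ℕ)) =
          ((Real.exp (-(l * y)) - 1 + l * y : ℝ) : ℂ) := by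
        push_cast [Nat.factorial]; ring
      rw [h3, Complex.norm_real, Complex.norm_real] at h2
      have h4 : ‖-(l * y)‖ ≤ l := by
        rw [norm_neg, norm_mul, Real.norm_of_nonneg hl.le, Real.norm_eq_abs]
        nlinarith
      calc _ ≤ ‖-(l * y)‖ ^ 2 * Real.exp ‖-(l * y)‖ := (le_abs_self _).trans h2
        _ = l ^ 2 * y ^ 2 * Real.exp ‖-(l * y)‖ := by
          rw [Real.norm_eq_abs, sq_abs]; ring
        _ ≤ _ := by gcongr
    have h5 : |Real.sin y - y| ≤ y ^ 2 := by
      have := Real.sin_bound hy1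
      have h6 : |y ^ 3 / 6| ≤ y ^ 2 / 6 := by
        rw [abs_div, abs_pow, abs_of_pos (by norm_num : (0 : ℝ) < 6), ← sq_abs y]
        have := abs_nonneg y
        gcongr 1
        exact pow_le_pow_of_le_one this hy1 (by norm_num)
      have h7 : |y| ^ 5 ≤ y ^ 2 := by
        rw [← sq_abs y]
        exact pow_le_pow_of_le_one (abs_nonneg y) hy1 (by norm_num)
      have h8 : Real.sin y - y = (Real.sin y - (y - y ^ 3 / 6)) + (-(y ^ 3 / 6)) := by ring
      rw [h8]
      refine (abs_add_le _ _).trans ?_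
      rw [abs_neg]
      nlinarith [sq_nonneg y]
    have h9 := sq_div_five_le_one_sub_cos hy1
    have h10 := abs_le.1 h5
    have h11 : 0 ≤ l ^ 2 * Real.exp l + l := by positivity
    nlinarith [mul_nonneg hη2 hc, mul_le_mul_of_nonneg_left h9 h11,
      mul_le_mul_of_nonneg_left h10.2 hl.le]
  · have h1 : Real.exp (-(l * y)) ≤ Real.exp (-l) := Real.exp_le_exp.2 (by nlinarith)
    have h2 : l * Real.sin y ≤ η + l ^ 2 / (2 * η) * (1 - Real.cos y) := by
      have h3 : Real.sin y ^ 2 ≤ 2 * (1 - Real.cos y) := by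
        nlinarith [Real.sin_sq_add_cos_sq y, Real.cos_le_one y, sq_nonneg (1 - Real.cos y)]
      have h4 : l * Real.sin y ≤ η + l ^ 2 / (4 * η) * Real.sin y ^ 2 := by
        have h5 : 0 ≤ (l * Real.sin y - 2 * η) ^ 2 / (4 * η) := by positivity
        have h6 : (l * Real.sin y - 2 * η) ^ 2 / (4 * η) =
          l ^ 2 / (4 * η) * Real.sin y ^ 2 - l * Real.sin y + η := by field_simp; ring
        linarith
      have h7 : l ^ 2 / (4 * η) * Real.sin y ^ 2 ≤ l ^ 2 / (4 * η) * (2 * (1 - Real.cos y)) := by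
        gcongr
      have h8 : l ^ 2 / (4 * η) * (2 * (1 - Real.cos y)) = l ^ 2 / (2 * η) * (1 - Real.cos y) := by
        field_simp; ring
      linarith
    have h3 : 0 ≤ 5 * (l ^ 2 * Real.exp l + l) * (1 - Real.cos y) := by positivity
    linarith

end LevyProcess

/-! ### Finiteness of exponential moments. -/

section ExponentialMoments

variable {Ω : Type*} [MeasurableSpace Ω] {P : Measure Ω} [IsProbabilityMeasure P]
  {X : ℝ≥0 → Ω → ℝ}

namespace IsLevyProcess

/-- The Laplace transforms of the increments truncated from below, over a mesh of the unit
interval, have bounded products. -/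
lemma exists_eventually_integral_pow_le (hX : IsLevyProcess P X) (hpos : HasOnlyPositiveJumps P X)
    {l : ℝ} (hl : 0 < l) : ∃ C : ℝ, ∀ᶠ n : ℕ in atTop,
      (∫ ω, Real.exp (-l * max (X (1 / (n + 1)) ω) (-1)) ∂P) ^ (n + 1) ≤ C := by
  obtain ⟨a, ha, hbound⟩ := exists_forall_exp_sub_one_le hl
  obtain ⟨ψ, hψ⟩ := hX.exists_charFun_eq_cexp 1
  have hm := hX.measurable
  -- On X < -1 the truncated exponential is exp(l), and the sine term can cost a further l.
  set K := Real.exp l + l with hK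
  set E : ℕ → ℂ := fun n => Complex.exp (((1 / (n + 1) : ℝ≥0) : ℂ) * ψ) with hE
  set p : ℕ → ℝ := fun n => P.real {ω | X (1 / (n + 1)) ω < -1} with hp
  set b : ℕ → ℝ := fun n => ∫ ω, Real.exp (-l * max (X (1 / (n + 1)) ω) (-1)) ∂P with hb
  have hb_le : ∀ n, b n ≤ 1 + a * (1 - (E n).re) + l * (E n).im + K * p n := by
    intro n
    have hmn := hm (1 / (n + 1))
    have hi : Integrable (fun ω => Complex.exp (-((1 * X (1 / (n + 1)) ω : ℝ) * Complex.I))) P :=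
      Integrable.of_bound (Measurable.aestronglyMeasurable (by fun_prop)) 1
        (ae_of_all _ fun ω => (norm_cexp_mul_I _).le)
    have hre : ∫ ω, Real.cos (X (1 / (n + 1)) ω) ∂P = (E n).re := by
      rw [hE]; simp only; rw [← hψ, ← Complex.reCLM_apply, ← Complex.reCLM.integral_comp_comm hi]
      congr 1; ext ω
      simp [Complex.exp_re]
    have him : ∫ ω, Real.sin (X (1 / (n + 1)) ω) ∂P = -(E n).im := by
      rw [hE]; simp only; rw [← hψ, ← Complex.imCLM_apply, ← Complex.imCLM.integral_comp_comm hi,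
        ← integral_neg]
      congr 1; ext ω
      simp [Complex.exp_im]
    have hic : Integrable (fun ω => Real.cos (X (1 / (n + 1)) ω)) P :=
      Integrable.of_bound (Measurable.aestronglyMeasurable (by fun_prop)) 1
        (ae_of_all _ fun ω => by simpa using Real.abs_cos_le_one _)
    have his : Integrable (fun ω => Real.sin (X (1 / (n + 1)) ω)) P :=
      Integrable.of_bound (Measurable.aestronglyMeasurable (by fun_prop)) 1
        (ae_of_all _ fun ω => by simpa using Real.abs_sin_le_one _)
    set S := {ω | X (1 / (n + 1)) ω < -1} with hS
    have hSm : MeasurableSet S := measurableSet_lt hmn measurable_const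
    have hiS : Integrable (S.indicator (fun _ => (1 : ℝ))) P :=
      (integrable_const _).indicator hSm
    have hpS : ∫ ω, S.indicator (fun _ => (1 : ℝ)) ω ∂P = p n := by
      rw [integral_indicator hSm]; simp [hp, hS]
    have hle : b n ≤ ∫ ω, (1 + a * (1 - Real.cos (X (1 / (n + 1)) ω)) +
        -l * Real.sin (X (1 / (n + 1)) ω) + K * S.indicator (fun _ => (1 : ℝ)) ω) ∂P := by
      refine integral_mono_of_nonneg (ae_of_all _ fun ω => (Real.exp_pos _).le) ?_
        (ae_of_all _ fun ω => ?_)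
      · fun_prop
      · simp only
        generalize hy : X (1 / (n + 1)) ω = y
        rcases le_or_gt (-1) y with h | h
        · have hnot : ω ∉ S := by rw [hS, Set.mem_ofPred_eq, hy]; exact not_lt.2 h
          have := hbound y h
          rw [max_eq_left h, Set.indicator_of_notMem hnot, neg_mul]
          linarith
        · have hin : ω ∈ S := by rw [hS, Set.mem_ofPred_eq, hy]; exact h
          rw [max_eq_right h.le, Set.indicator_of_mem hin, hK]
          have h1 : 0 ≤ a * (1 - Real.cos y) := mul_nonneg ha (by linarith [Real.cos_le_one y])
          have h2 : l * Real.sin y ≤ l := by nlinarith [Real.sin_le_one y]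
          rw [show -l * -1 = l by ring]
          linarith
    refine hle.trans (le_of_eq ?_)
    rw [integral_add (by fun_prop) (by fun_prop), integral_add (by fun_prop) (by fun_prop),
      integral_add (by fun_prop) (by fun_prop), integral_const_mul, integral_const_mul,
      integral_const_mul, integral_sub (by fun_prop) (by fun_prop), hre, him, hpS]
    simp
  have hlim := tendsto_mul_cexp_sub_one ψ
  have hlimp := hX.tendsto_mul_measureReal_lt hpos one_pos
  -- The bound on (n+1)(b n - 1) converges: the trigonometric part to the generator, the tail part
  -- to 0. Then b ≤ exp(b - 1) bounds the power.
  have hc := (((Complex.continuous_re.tendsto _).comp hlim).const_mul (-a)).add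
    (((Complex.continuous_im.tendsto _).comp hlim).const_mul l) |>.add (hlimp.const_mul K)
  obtain ⟨C, hC⟩ : ∃ C, -a * ψ.re + l * ψ.im + K * 0 < C := exists_gt _
  refine ⟨Real.exp C, ?_⟩
  filter_upwards [hc.eventually_lt_const hC] with n hn
  have hb0 : 0 ≤ b n := integral_nonneg fun ω => (Real.exp_pos _).le
  have h1 : ((n : ℝ) + 1) * (b n - 1) ≤ C := by
    refine le_trans ?_ hn.le
    have h2 : (((n : ℂ) + 1) * (E n - 1)).re = ((n : ℝ) + 1) * ((E n).re - 1) := by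
      rw [show (n : ℂ) + 1 = ((n + 1 : ℝ) : ℂ) by push_cast; rfl, Complex.re_ofReal_mul]; simp
    have h3 : (((n : ℂ) + 1) * (E n - 1)).im = ((n : ℝ) + 1) * (E n).im := by
      rw [show (n : ℂ) + 1 = ((n + 1 : ℝ) : ℂ) by push_cast; rfl, Complex.im_ofReal_mul]; simp
    simp only [Function.comp]
    rw [h2, h3]
    have := mul_le_mul_of_nonneg_left (hb_le n) (show (0 : ℝ) ≤ (n : ℝ) + 1 by positivity)
    simp only [hp] at this
    linarith
  calc b n ^ (n + 1) ≤ Real.exp (b n - 1) ^ (n + 1) := by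
        gcongr; linarith [Real.add_one_le_exp (b n - 1)]
    _ = Real.exp (((n : ℝ) + 1) * (b n - 1)) := by
        rw [← Real.exp_nat_mul]; push_cast; rfl
    _ ≤ Real.exp C := Real.exp_le_exp.2 h1

/-- Almost surely, on a fine enough mesh no increment lies below -1, so the truncated increments sum
to X_1. By independence the transforms of these sums are the bounded powers above, and Fatou
concludes. -/
lemma lintegral_exp_one_lt_top (hX : IsLevyProcess P X) (hpos : HasOnlyPositiveJumps P X)
    {l : ℝ} (hl : 0 < l) : ∫⁻ ω, ENNReal.ofReal (Real.exp (-l * X 1 ω)) ∂P < ⊤ := by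
  have hm := hX.measurable
  obtain ⟨C, hC⟩ := hX.exists_eventually_integral_pow_le hpos hl
  set W : ℕ → ℕ → Ω → ℝ := fun n k ω =>
    max (X (((k + 1 : ℕ) : ℝ≥0) / (n + 1)) ω - X ((k : ℝ≥0) / (n + 1)) ω) (-1) with hW
  have hWm : ∀ n k, Measurable (W n k) := fun n k =>
    (hX.measurable_mesh n k).max measurable_const
  have hmgf : ∀ n, mgf (∑ k ∈ Finset.range (n + 1), W n k) P (-l) =
      (∫ ω, Real.exp (-l * max (X (1 / (n + 1)) ω) (-1)) ∂P) ^ (n + 1) := by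
    intro n
    have hind : iIndepFun (W n) P := (hX.iIndepFun_mesh n).comp (fun _ x => max x (-1))
      (fun _ => measurable_id.max measurable_const)
    rw [hind.mgf_sum (hWm n)]
    have h1 : ∀ k, mgf (W n k) P (-l) =
        ∫ ω, Real.exp (-l * max (X (1 / (n + 1)) ω) (-1)) ∂P := fun k =>
      congrFun (mgf_congr_identDistrib ((hX.identDistrib_mesh n k).comp
        (measurable_id.max (measurable_const : Measurable fun _ : ℝ => (-1 : ℝ))))) (-l)
    simp [h1]
  set F : ℕ → Ω → ENNReal := fun n ω =>
    ENNReal.ofReal (Real.exp (-l * (∑ k ∈ Finset.range (n + 1), W n k) ω)) with hF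
  have hFm : ∀ n, Measurable (F n) := fun n => by
    have : Measurable (∑ k ∈ Finset.range (n + 1), W n k) :=
      Finset.sum_induction _ Measurable (fun _ _ => Measurable.add) measurable_zero
        fun k _ => hWm n k
    fun_prop
  have hFi : ∀ n, ∫⁻ ω, F n ω ∂P =
      ENNReal.ofReal ((∫ ω, Real.exp (-l * max (X (1 / (n + 1)) ω) (-1)) ∂P) ^ (n + 1)) := by
    intro n
    have hms : Measurable (∑ k ∈ Finset.range (n + 1), W n k) :=
      Finset.sum_induction _ Measurable (fun _ _ => Measurable.add) measurable_zero
        fun k _ => hWm n k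
    rw [← hmgf, mgf, ofReal_integral_eq_lintegral_ofReal _ (ae_of_all _ fun ω => (Real.exp_pos _).le)]
    refine Integrable.of_bound (Measurable.aestronglyMeasurable (by fun_prop))
      (Real.exp (l * (n + 1))) (ae_of_all _ fun ω => ?_)
    rw [Real.norm_of_nonneg (Real.exp_pos _).le]
    refine Real.exp_le_exp.2 ?_
    have : -((n : ℝ) + 1) ≤ (∑ k ∈ Finset.range (n + 1), W n k) ω := by
      rw [Finset.sum_apply]
      have := Finset.card_nsmul_le_sum (Finset.range (n + 1)) (fun k => W n k ω) (-1)
        (fun k _ => le_max_right _ _)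
      simp only [Finset.card_range, nsmul_eq_mul] at this
      push_cast at this
      linarith
    nlinarith
  have hlim : ∀ᵐ ω ∂P, ENNReal.ofReal (Real.exp (-l * X 1 ω)) = liminf (fun n => F n ω) atTop := by
    filter_upwards [hX.start_zero, hX.ae_eventually_mesh hpos one_pos] with ω h0 hω
    have : Tendsto (fun n => F n ω) atTop (𝓝 (ENNReal.ofReal (Real.exp (-l * X 1 ω)))) := by
      refine tendsto_const_nhds.congr' ?_
      filter_upwards [hω] with n hn
      have : (∑ k ∈ Finset.range (n + 1), W n k) ω = X 1 ω := by
        rw [Finset.sum_apply]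
        have h1 : ∀ k ∈ Finset.range (n + 1), W n k ω =
            X (((k + 1 : ℕ) : ℝ≥0) / (n + 1)) ω - X ((k : ℝ≥0) / (n + 1)) ω := fun k hk =>
          max_eq_left (hn k hk)
        rw [Finset.sum_congr rfl h1,
          Finset.sum_range_sub (fun k : ℕ => X ((k : ℝ≥0) / (n + 1)) ω)]
        simp [h0]
      simp only [hF, this]
    exact this.liminf_eq.symm
  rw [lintegral_congr_ae hlim]
  refine (lintegral_liminf_le hFm).trans_lt ?_
  refine lt_of_le_of_lt ?_ (ENNReal.ofReal_lt_top (r := C))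
  simp_rw [hFi]
  refine liminf_le_of_frequently_le' (hC.mono fun n hn => ENNReal.ofReal_le_ofReal hn).frequently

/-- Multiplicativity gives integer times. A general t ≤ n contributes one factor of a finite product
whose other factor, at time n - t, is positive. -/
lemma lintegral_exp_lt_top (hX : IsLevyProcess P X) (hpos : HasOnlyPositiveJumps P X)
    {l : ℝ} (hl : 0 < l) (t : ℝ≥0) : ∫⁻ ω, ENNReal.ofReal (Real.exp (-l * X t ω)) ∂P < ⊤ := by
  have hmul : ∀ s t : ℝ≥0, ∫⁻ ω, ENNReal.ofReal (Real.exp (-l * X (s + t) ω)) ∂P =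
      (∫⁻ ω, ENNReal.ofReal (Real.exp (-l * X s ω)) ∂P) *
        ∫⁻ ω, ENNReal.ofReal (Real.exp (-l * X t ω)) ∂P := fun s t =>
    hX.lintegral_comp_add (F := fun x => ENNReal.ofReal (Real.exp (-l * x))) (by fun_prop)
      (fun x y => by
        rw [← ENNReal.ofReal_mul (Real.exp_pos _).le, ← Real.exp_add, mul_add]) s t
  have h1 := hX.lintegral_exp_one_lt_top hpos hl
  have hn : ∀ n : ℕ, ∫⁻ ω, ENNReal.ofReal (Real.exp (-l * X n ω)) ∂P < ⊤ := by
    intro n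
    induction n with
    | zero =>
      have : (fun ω => ENNReal.ofReal (Real.exp (-l * X 0 ω))) =ᵐ[P] fun _ => 1 := by
        filter_upwards [hX.start_zero] with ω h
        simp [h]
      rw [Nat.cast_zero, lintegral_congr_ae this]
      simp
    | succ n ih => rw [Nat.cast_succ, hmul]; exact ENNReal.mul_lt_top ih h1
  obtain ⟨n, hnt⟩ := exists_nat_ge t
  have h2 := hn n
  rw [← add_tsub_cancel_of_le hnt, hmul] at h2
  refine ENNReal.lt_top_of_mul_ne_top_left h2.ne ?_
  have hmm := hX.measurable (n - t)
  rw [← pos_iff_ne_zero, lintegral_pos_iff_support (by fun_prop)]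
  have : Function.support (fun ω => ENNReal.ofReal (Real.exp (-l * X (n - t) ω))) = Set.univ := by
    ext ω; simp [Real.exp_pos]
  rw [this]; simp

lemma integrable_exp (hX : IsLevyProcess P X) (hpos : HasOnlyPositiveJumps P X)
    {l : ℝ} (hl : 0 ≤ l) (t : ℝ≥0) : Integrable (fun ω => Real.exp (-l * X t ω)) P := by
  rcases hl.eq_or_lt with rfl | hl
  · simp
  have hm := hX.measurable t
  refine ⟨Measurable.aestronglyMeasurable (by fun_prop), ?_⟩
  rw [hasFiniteIntegral_iff_ofReal (ae_of_all _ fun ω => (Real.exp_pos _).le)]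
  exact hX.lintegral_exp_lt_top hpos hl t

end IsLevyProcess

end ExponentialMoments

/-! ### The exponent on the closed right half-plane, and moments of tilted laws. -/

section LaplaceExponent

variable {Ω : Type*} [MeasurableSpace Ω] {P : Measure Ω} {X : ℝ≥0 → Ω → ℝ}

namespace IsLevyProcess

lemma integral_exp_add (hX : IsLevyProcess P X) (l : ℝ) (s t : ℝ≥0) :
    ∫ ω, Real.exp (-l * X (s + t) ω) ∂P =
      (∫ ω, Real.exp (-l * X s ω) ∂P) * ∫ ω, Real.exp (-l * X t ω) ∂P := by
  have h := hX.integral_comp_add (F := fun x : ℝ => ((Real.exp (-l * x) : ℝ) : ℂ)) (by fun_prop)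
    (fun x y => by rw [← Complex.ofReal_mul, ← Real.exp_add, mul_add]) s t
  simp only [integral_complex_ofReal] at h
  exact_mod_cast h

lemma laplaceExponent_eq_cgf : laplaceExponent P X = fun l => cgf (X 1) P (-l) := rfl

lemma deriv_laplaceExponent :
    deriv (laplaceExponent P X) = fun l => -deriv (cgf (X 1) P) (-l) := by
  ext l
  rw [laplaceExponent_eq_cgf, deriv_comp_neg]

lemma deriv_deriv_laplaceExponent :
    deriv (deriv (laplaceExponent P X)) = fun l => deriv (deriv (cgf (X 1) P)) (-l) := by
  ext l
  rw [deriv_laplaceExponent, deriv.fun_neg, deriv_comp_neg (deriv (cgf (X 1) P)), neg_neg]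

variable [IsProbabilityMeasure P]

/-- No dominating function for exp(-l X_t) is at hand. Truncating at 1 still gives a lower bound
near time 0, and the logarithm, additive in t and bounded below there, must tend to 0. -/
lemma tendsto_integral_exp (hX : IsLevyProcess P X) (hpos : HasOnlyPositiveJumps P X)
    {l : ℝ} (hl : 0 ≤ l) : Tendsto (fun t => ∫ ω, Real.exp (-l * X t ω) ∂P) (𝓝 0) (𝓝 1) := by
  have hm := hX.measurable
  set g : ℝ≥0 → ℝ := fun t => ∫ ω, Real.exp (-l * X t ω) ∂P with hg
  have hint := hX.integrable_exp hpos hl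
  have hmin : Tendsto (fun t => ∫ ω, min (Real.exp (-l * X t ω)) 1 ∂P) (𝓝 0) (𝓝 1) := by
    have : Tendsto (fun t => ∫ ω, min (Real.exp (-l * X t ω)) 1 ∂P) (𝓝 0)
        (𝓝 (∫ _, (1 : ℝ) ∂P)) := by
      refine tendsto_integral_filter_of_dominated_convergence (fun _ => 1)
        (Eventually.of_forall fun t => ?_) (Eventually.of_forall fun t => ae_of_all _ fun ω => ?_)
        (integrable_const _) ?_
      · have := hm t
        exact Measurable.aestronglyMeasurable (by fun_prop)
      · rw [Real.norm_of_nonneg (by positivity)]; exact min_le_right _ _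
      · filter_upwards [hX.ae_tendsto_zero] with ω h
        have hc : Continuous fun x : ℝ => min (Real.exp (-l * x)) 1 := by fun_prop
        have := (hc.tendsto 0).comp h
        simpa [Function.comp_def] using this
    simpa using this
  have hge : ∀ t, ∫ ω, min (Real.exp (-l * X t ω)) 1 ∂P ≤ g t := fun t =>
    integral_mono_of_nonneg (ae_of_all _ fun ω => by positivity) (hint t)
      (ae_of_all _ fun ω => min_le_left _ _)
  have hgpos : ∀ t, 0 < g t := fun t => integral_exp_pos (hint t)
  have hG := NNReal.tendsto_zero_of_map_add (G := fun t => Real.log (g t)) (K := Real.log 2)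
    (fun s t => by
      rw [← Real.log_mul (hgpos s).ne' (hgpos t).ne', hg]; simp only; rw [hX.integral_exp_add])
    (by
      filter_upwards [hmin.eventually (lt_mem_nhds (show (1 / 2 : ℝ) < 1 by norm_num))] with t ht
      rw [← Real.log_inv]
      exact Real.log_le_log (by norm_num) (by rw [← one_div]; exact ht.le.trans (hge t)))
  have := (Real.continuous_exp.tendsto 0).comp hG
  rw [Real.exp_zero] at this
  exact this.congr fun t => Real.exp_log (hgpos t)

/-- `E exp(-z X_t) = exp(t ψ(z))` on the closed right half-plane. -/
lemma exists_integral_cexp_eq (hX : IsLevyProcess P X) (hpos : HasOnlyPositiveJumps P X)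
    {w : ℝ} (hw : 0 ≤ w) (u : ℝ) : ∃ ψ : ℂ, ∀ t : ℝ≥0,
      ∫ ω, Complex.exp (-((w + u * Complex.I) * X t ω)) ∂P = Complex.exp (t * ψ) := by
  have hm := hX.measurable
  have h0 : ∫ ω, Complex.exp (-((w + u * Complex.I) * X 0 ω)) ∂P = 1 := by
    have : (fun ω => Complex.exp (-((w + u * Complex.I) * X 0 ω))) =ᵐ[P] fun _ => 1 := by
      filter_upwards [hX.start_zero] with ω h
      simp [h]
    rw [integral_congr_ae this]; simp
  have hint := hX.integrable_exp hpos hw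
  have hnorm : ∀ x : ℝ, ‖Complex.exp (-((w + u * Complex.I) * x))‖ = Real.exp (-w * x) := by
    intro x
    rw [Complex.norm_exp]; simp
  have hintc : ∀ t, Integrable (fun ω => Complex.exp (-((w + u * Complex.I) * X t ω))) P := by
    intro t
    have := hm t
    refine (hint t).mono' (Measurable.aestronglyMeasurable (by fun_prop)) (ae_of_all _ fun ω => ?_)
    rw [hnorm]
  refine NNReal.exists_eq_cexp_of_map_add_eq_mul h0 (fun s t => ?_) ?_
  · refine hX.integral_comp_add (F := fun x : ℝ => Complex.exp (-((w + u * Complex.I) * x)))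
      (by fun_prop) (fun x y => ?_) s t
    rw [← Complex.exp_add]; push_cast; congr 1; ring
  · rw [ContinuousAt, h0, tendsto_iff_norm_sub_tendsto_zero]
    -- B is bounded and vanishes at 0, and |exp(-(w+iu)x) - 1| ≤ exp(-wx) - 1 + B(x). The unbounded
    -- part is thus handled by convergence of the real Laplace transform.
    set B : ℝ → ℝ := fun x => 2 * max (1 - Real.exp (-w * x)) 0 +
      ‖Complex.exp (-((u * x : ℝ) * Complex.I)) - 1‖ with hB
    have hBle : ∀ x, ‖B x‖ ≤ 4 := by
      intro x
      rw [Real.norm_of_nonneg (by positivity)]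
      have h1 : max (1 - Real.exp (-w * x)) 0 ≤ 1 :=
        max_le (by linarith [Real.exp_pos (-w * x)]) zero_le_one
      have h2 := norm_sub_le (Complex.exp (-((u * x : ℝ) * Complex.I))) 1
      rw [norm_cexp_mul_I, norm_one] at h2
      simp only [hB]; linarith
    have hBc : Continuous B := by fun_prop
    have hBi : ∀ t, Integrable (fun ω => B (X t ω)) P := fun t =>
      Integrable.of_bound (hBc.measurable.comp (hm t)).aestronglyMeasurable 4
        (ae_of_all _ fun ω => hBle _)
    have hBlim : Tendsto (fun t => ∫ ω, B (X t ω) ∂P) (𝓝 0) (𝓝 0) := by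
      have : Tendsto (fun t => ∫ ω, B (X t ω) ∂P) (𝓝 0) (𝓝 (∫ _, (0 : ℝ) ∂P)) := by
        refine tendsto_integral_filter_of_dominated_convergence (fun _ => 4)
          (Eventually.of_forall fun t => (hBi t).aestronglyMeasurable)
          (Eventually.of_forall fun t => ae_of_all _ fun ω => hBle _) (integrable_const _) ?_
        filter_upwards [hX.ae_tendsto_zero] with ω h
        have := (hBc.tendsto 0).comp h
        simpa [Function.comp_def, hB] using this
      simpa using this
    have hlim := ((hX.tendsto_integral_exp hpos hw).sub_const 1).add hBlim
    simp only [sub_self, add_zero] at hlim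
    refine squeeze_zero (fun _ => norm_nonneg _) (fun t => ?_) hlim
    have h1 : ∫ ω, Complex.exp (-((w + u * Complex.I) * X t ω)) ∂P - 1 =
        ∫ ω, (Complex.exp (-((w + u * Complex.I) * X t ω)) - 1) ∂P := by
      rw [integral_sub (hintc t) (integrable_const _)]; simp
    have h2 : ∫ ω, Real.exp (-w * X t ω) ∂P - 1 + ∫ ω, B (X t ω) ∂P =
        ∫ ω, (Real.exp (-w * X t ω) - 1 + B (X t ω)) ∂P := by
      have h3 : Integrable (fun ω => Real.exp (-w * X t ω) - 1) P :=
        (hint t).sub (integrable_const _)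
      rw [integral_add h3 (hBi t), integral_sub (hint t) (integrable_const _)]; simp
    rw [h1, h2]
    refine norm_integral_le_of_norm_le (((hint t).sub (integrable_const _)).add (hBi t))
      (ae_of_all _ fun ω => ?_)
    generalize X t ω = x
    have h3 : Complex.exp (-((w + u * Complex.I) * x)) - 1 =
        ((Real.exp (-w * x) - 1 : ℝ) : ℂ) * Complex.exp (-((u * x : ℝ) * Complex.I)) +
          (Complex.exp (-((u * x : ℝ) * Complex.I)) - 1) := by
      have : Complex.exp (-((w + u * Complex.I) * x)) =
          ((Real.exp (-w * x) : ℝ) : ℂ) * Complex.exp (-((u * x : ℝ) * Complex.I)) := by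
        rw [Complex.ofReal_exp, ← Complex.exp_add]; push_cast; congr 1; ring
      rw [this]; push_cast; ring
    rw [h3]
    refine (norm_add_le _ _).trans ?_
    rw [norm_mul, norm_cexp_mul_I, mul_one, Complex.norm_real, Real.norm_eq_abs]
    simp only [hB]
    have h4 : |Real.exp (-w * x) - 1| ≤
        Real.exp (-w * x) - 1 + 2 * max (1 - Real.exp (-w * x)) 0 := by
      refine abs_le.2 ⟨?_, ?_⟩ <;>
        linarith [le_max_left (1 - Real.exp (-w * x)) 0, le_max_right (1 - Real.exp (-w * x)) 0]
    linarith

lemma integral_exp_eq (hX : IsLevyProcess P X) (hpos : HasOnlyPositiveJumps P X)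
    {l : ℝ} (hl : 0 ≤ l) (t : ℝ≥0) :
    ∫ ω, Real.exp (-l * X t ω) ∂P = Real.exp (t * laplaceExponent P X l) := by
  have hgpos : ∀ t, 0 < ∫ ω, Real.exp (-l * X t ω) ∂P := fun t =>
    integral_exp_pos (hX.integrable_exp hpos hl t)
  obtain ⟨ψ, hψ⟩ := hX.exists_integral_cexp_eq hpos hl 0
  have h1 : ∀ t : ℝ≥0, ((∫ ω, Real.exp (-l * X t ω) ∂P : ℝ) : ℂ) = Complex.exp (t * ψ) := by
    intro t
    rw [← hψ, ← integral_complex_ofReal]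
    congr 1; ext ω; push_cast; simp
  -- Taking moduli avoids any choice of branch for ψ.
  have h2 : ∀ t : ℝ≥0, ∫ ω, Real.exp (-l * X t ω) ∂P = Real.exp (t * ψ.re) := by
    intro t
    have := congrArg norm (h1 t)
    rw [Complex.norm_real, Real.norm_of_nonneg (hgpos t).le, Complex.norm_exp] at this
    simpa using this
  rw [h2 t, laplaceExponent, h2 1]
  simp

section Derivatives

variable {w : ℝ}

lemma neg_mem_interior_integrableExpSet (hX : IsLevyProcess P X) (hpos : HasOnlyPositiveJumps P X)
    (hw : 0 < w) (t : ℝ≥0) : -w ∈ interior (integrableExpSet (X t) P) := by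
  rw [mem_interior_iff_mem_nhds]
  filter_upwards [Iio_mem_nhds (show -w < 0 by linarith)] with v hv
  have := hX.integrable_exp hpos (l := -v) (by linarith [Set.mem_Iio.1 hv]) t
  simpa [integrableExpSet] using this

lemma continuousAt_deriv_deriv_laplaceExponent (hX : IsLevyProcess P X)
    (hpos : HasOnlyPositiveJumps P X) (hw : 0 < w) :
    ContinuousAt (deriv (deriv (laplaceExponent P X))) w := by
  rw [deriv_deriv_laplaceExponent]
  have := (analyticAt_cgf (hX.neg_mem_interior_integrableExpSet hpos hw 1)).deriv.deriv.continuousAt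
  exact ContinuousAt.comp (f := fun l : ℝ => -l) this continuous_neg.continuousAt

lemma mgf_eq_exp (hX : IsLevyProcess P X) (hpos : HasOnlyPositiveJumps P X) (t : ℝ≥0) {v : ℝ}
    (hv : v ≤ 0) : mgf (X t) P v = Real.exp (t * cgf (X 1) P v) := by
  have := hX.integral_exp_eq hpos (l := -v) (by linarith) t
  rw [laplaceExponent_eq_cgf] at this
  simpa [mgf] using this

lemma integral_mul_exp_aux (hX : IsLevyProcess P X) (hpos : HasOnlyPositiveJumps P X) (t : ℝ≥0)
    (hw : 0 < w) : ∫ ω, X t ω * Real.exp (-w * X t ω) ∂P =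
      t * deriv (cgf (X 1) P) (-w) * Real.exp (t * cgf (X 1) P (-w)) := by
  have h1 := hasDerivAt_mgf (hX.neg_mem_interior_integrableExpSet hpos hw t)
  have h2 := (analyticAt_cgf (hX.neg_mem_interior_integrableExpSet hpos hw
    1)).differentiableAt.hasDerivAt.const_mul (t : ℝ) |>.exp
  have h3 : mgf (X t) P =ᶠ[𝓝 (-w)] fun v => Real.exp (t * cgf (X 1) P v) := by
    filter_upwards [Iio_mem_nhds (show -w < 0 by linarith)] with v hv
    exact hX.mgf_eq_exp hpos t (le_of_lt hv)
  rw [h1.unique (h2.congr_of_eventuallyEq h3)]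
  ring

lemma integral_mul_exp (hX : IsLevyProcess P X) (hpos : HasOnlyPositiveJumps P X) (t : ℝ≥0)
    (hw : 0 < w) : ∫ ω, X t ω * Real.exp (-w * X t ω) ∂P =
      -(t * deriv (laplaceExponent P X) w) * Real.exp (t * laplaceExponent P X w) := by
  rw [hX.integral_mul_exp_aux hpos t hw, deriv_laplaceExponent, laplaceExponent_eq_cgf]
  ring

lemma integral_sq_mul_exp (hX : IsLevyProcess P X) (hpos : HasOnlyPositiveJumps P X) (t : ℝ≥0)
    (hw : 0 < w) : ∫ ω, X t ω ^ 2 * Real.exp (-w * X t ω) ∂P =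
      (t * deriv (deriv (laplaceExponent P X)) w + (t * deriv (laplaceExponent P X) w) ^ 2) *
        Real.exp (t * laplaceExponent P X w) := by
  have h1 := hasDerivAt_integral_pow_mul_exp_real
    (hX.neg_mem_interior_integrableExpSet hpos hw t) 1
  have ha := analyticAt_cgf (hX.neg_mem_interior_integrableExpSet hpos hw 1)
  have h2 := (ha.deriv.differentiableAt.hasDerivAt.const_mul (t : ℝ)).mul
    (ha.differentiableAt.hasDerivAt.const_mul (t : ℝ)).exp
  have h3 : (fun v => ∫ ω, X t ω ^ 1 * Real.exp (v * X t ω) ∂P) =ᶠ[𝓝 (-w)]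
      fun v => t * deriv (cgf (X 1) P) v * Real.exp (t * cgf (X 1) P v) := by
    filter_upwards [Iio_mem_nhds (show -w < 0 by linarith)] with v hv
    have := hX.integral_mul_exp_aux hpos t (w := -v) (by linarith [Set.mem_Iio.1 hv])
    simpa using this
  rw [h1.unique (h2.congr_of_eventuallyEq h3), deriv_deriv_laplaceExponent, deriv_laplaceExponent,
    laplaceExponent_eq_cgf]
  ring

lemma integrable_pow_mul_exp (hX : IsLevyProcess P X) (hpos : HasOnlyPositiveJumps P X) (t : ℝ≥0)
    (hw : 0 < w) (k : ℕ) : Integrable (fun ω => X t ω ^ k * Real.exp (-w * X t ω)) P :=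
  integrable_pow_mul_exp_of_mem_interior_integrableExpSet
    (hX.neg_mem_interior_integrableExpSet hpos hw t) k

/-- The law tilted by exp(-w X_t) has mean -tφ'(w) and variance tφ''(w). -/
lemma integral_centered_sq_mul_exp (hX : IsLevyProcess P X) (hpos : HasOnlyPositiveJumps P X)
    (t : ℝ≥0) (hw : 0 < w) :
    ∫ ω, (X t ω + t * deriv (laplaceExponent P X) w) ^ 2 * Real.exp (-w * X t ω) ∂P =
      t * deriv (deriv (laplaceExponent P X)) w * Real.exp (t * laplaceExponent P X w) := by
  have h2 := hX.integrable_pow_mul_exp hpos t hw 2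
  have h1 := hX.integrable_pow_mul_exp hpos t hw 1
  simp only [pow_one] at h1
  have h0 := hX.integrable_exp hpos hw.le t
  set d := t * deriv (laplaceExponent P X) w
  have : ∀ ω, (X t ω + d) ^ 2 * Real.exp (-w * X t ω) = X t ω ^ 2 * Real.exp (-w * X t ω) +
      2 * d * (X t ω * Real.exp (-w * X t ω)) + d ^ 2 * Real.exp (-w * X t ω) := fun ω => by ring
  simp_rw [this]
  rw [integral_add (by fun_prop) (by fun_prop), integral_add (by fun_prop) (by fun_prop),
    integral_const_mul, integral_const_mul, hX.integral_mul_exp hpos t hw,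
    hX.integral_sq_mul_exp hpos t hw, hX.integral_exp_eq hpos hw.le]
  ring

lemma integrable_centered_sq_mul_exp (hX : IsLevyProcess P X) (hpos : HasOnlyPositiveJumps P X)
    (t : ℝ≥0) (hw : 0 < w) (d : ℝ) :
    Integrable (fun ω => (X t ω + d) ^ 2 * Real.exp (-w * X t ω)) P := by
  have h2 := hX.integrable_pow_mul_exp hpos t hw 2
  have h1 := hX.integrable_pow_mul_exp hpos t hw 1
  simp only [pow_one] at h1
  have h0 := hX.integrable_exp hpos hw.le t
  refine ((h2.add (h1.const_mul (2 * d))).add (h0.const_mul (d ^ 2))).congr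
    (ae_of_all _ fun ω => ?_)
  simp only [Pi.add_apply]; ring

lemma deriv_deriv_laplaceExponent_nonneg (hX : IsLevyProcess P X)
    (hpos : HasOnlyPositiveJumps P X) (hw : 0 < w) :
    0 ≤ deriv (deriv (laplaceExponent P X)) w := by
  have h := hX.integral_centered_sq_mul_exp hpos 1 hw
  have h1 : 0 ≤ ∫ ω, (X 1 ω + (1 : ℝ≥0) * deriv (laplaceExponent P X) w) ^ 2 *
      Real.exp (-w * X 1 ω) ∂P := integral_nonneg fun ω => by positivity
  rw [h] at h1
  simp only [NNReal.coe_one, one_mul] at h1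
  exact nonneg_of_mul_nonneg_left h1 (Real.exp_pos _)

end Derivatives

end IsLevyProcess

/-- Unbounded variation forces a non-degenerate law. -/
lemma IsSpectrallyPositiveOfUnboundedVariation.deriv_deriv_laplaceExponent_pos
    [IsProbabilityMeasure P] (hX : IsSpectrallyPositiveOfUnboundedVariation P X) {w : ℝ} (hw : 0 < w) :
    0 < deriv (deriv (laplaceExponent P X)) w := by
  have hL := hX.levy
  have hpos := hX.only_positive_jumps
  refine (hL.deriv_deriv_laplaceExponent_nonneg hpos hw).lt_of_ne' fun h0 => ?_
  refine hX.unbounded_variation ?_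
  -- If φ''(w) = 0, every tilted variance vanishes, so X_t = -dt almost surely for each t. A
  -- countable dense set of times and right-continuity make the whole path linear.
  set d := deriv (laplaceExponent P X) w
  have h1 : ∀ t : ℝ≥0, ∀ᵐ ω ∂P, X t ω = -d * t := by
    intro t
    have h := hL.integral_centered_sq_mul_exp hpos t hw
    rw [h0, mul_zero, zero_mul, integral_eq_zero_iff_of_nonneg (fun ω => by positivity)
      (hL.integrable_centered_sq_mul_exp hpos t hw _)] at h
    filter_upwards [h] with ω hω
    have h2 := (mul_eq_zero.1 hω).resolve_right (Real.exp_pos _).ne'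
    have h3 := pow_eq_zero_iff (two_ne_zero) |>.1 h2
    linarith
  obtain ⟨D, hDc, hDd⟩ := TopologicalSpace.exists_countable_dense ℝ≥0
  have h2 : ∀ᵐ ω ∂P, ∀ t ∈ D, X t ω = -d * t := (ae_ball_iff hDc).2 fun t _ => h1 t
  filter_upwards [h2, hL.right_continuous] with ω hω hr
  have h3 : ∀ t, X t ω = -d * t := by
    intro t
    have hcl : t ∈ closure (Set.Ioi t ∩ D) := by
      refine closure_minimal (hDd.open_subset_closure_inter isOpen_Ioi) isClosed_closure ?_
      rw [closure_Ioi]; exact Set.self_mem_Ici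
    have hne : (𝓝[Set.Ioi t ∩ D] t).NeBot := mem_closure_iff_nhdsWithin_neBot.1 hcl
    have ha : Tendsto (fun s => X s ω) (𝓝[Set.Ioi t ∩ D] t) (𝓝 (X t ω)) :=
      (hr t).mono_left (nhdsWithin_mono _ fun s hs => (Set.mem_Ioi.1 hs.1).le)
    have hb : Tendsto (fun s : ℝ≥0 => -d * s) (𝓝[Set.Ioi t ∩ D] t) (𝓝 (-d * t)) := by
      have : Continuous fun s : ℝ≥0 => -d * (s : ℝ) := by fun_prop
      exact (this.tendsto t).mono_left nhdsWithin_le_nhds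
    refine tendsto_nhds_unique ha (hb.congr' ?_)
    filter_upwards [self_mem_nhdsWithin] with s hs
    exact (hω s hs.2).symm
  simp_rw [h3]
  have hmono : MonotoneOn (fun t : ℝ≥0 => (t : ℝ)) Set.univ := fun s _ t _ hst => hst
  exact (lipschitzWith_smul (-d)).comp_locallyBoundedVariationOn hmono.locallyBoundedVariationOn

end LaplaceExponent

/-! ### The generator at the origin as a substitute for the Lévy–Khintchine formula. -/

section MeshLimit

variable {Ω : Type*} [MeasurableSpace Ω] {P : Measure Ω} {X : ℝ≥0 → Ω → ℝ}
  {E F : Type*} [NormedAddCommGroup E] [NormedSpace ℝ E] [NormedAddCommGroup F] [NormedSpace ℝ F]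

/-- `n E f(X_{1/n})` converges to `L`: the generator of the process applied to `f` at the origin,
for functions `f` vanishing there. -/
structure HasMeshLimit (P : Measure Ω) (X : ℝ≥0 → Ω → ℝ) (f : ℝ → E) (L : E) : Prop where
  integrable : ∀ n : ℕ, Integrable (fun ω => f (X (1 / (n + 1)) ω)) P
  tendsto : Tendsto (fun n : ℕ => ((n : ℝ) + 1) • ∫ ω, f (X (1 / (n + 1)) ω) ∂P) atTop (𝓝 L)

namespace HasMeshLimit

lemma add {f g : ℝ → E} {L M : E} (hf : HasMeshLimit P X f L) (hg : HasMeshLimit P X g M) :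
    HasMeshLimit P X (fun y => f y + g y) (L + M) where
  integrable n := (hf.integrable n).add (hg.integrable n)
  tendsto := (hf.tendsto.add hg.tendsto).congr fun n => by
    rw [integral_add (hf.integrable n) (hg.integrable n), smul_add]

lemma sub {f g : ℝ → E} {L M : E} (hf : HasMeshLimit P X f L) (hg : HasMeshLimit P X g M) :
    HasMeshLimit P X (fun y => f y - g y) (L - M) where
  integrable n := (hf.integrable n).sub (hg.integrable n)
  tendsto := (hf.tendsto.sub hg.tendsto).congr fun n => by
    rw [integral_sub (hf.integrable n) (hg.integrable n), smul_sub]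

lemma clm_comp [CompleteSpace E] [CompleteSpace F] (T : E →L[ℝ] F) {f : ℝ → E} {L : E}
    (hf : HasMeshLimit P X f L) : HasMeshLimit P X (fun y => T (f y)) (T L) where
  integrable n := T.integrable_comp (hf.integrable n)
  tendsto := ((T.continuous.tendsto L).comp hf.tendsto).congr fun n => by
    rw [T.integral_comp_comm (hf.integrable n)]; simp

lemma const_mul (c : ℝ) {f : ℝ → ℝ} {L : ℝ} (hf : HasMeshLimit P X f L) :
    HasMeshLimit P X (fun y => c * f y) (c * L) :=
  hf.clm_comp (c • ContinuousLinearMap.id ℝ ℝ)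

lemma norm_le {f : ℝ → E} {g : ℝ → ℝ} {L : E} {M : ℝ} (hf : HasMeshLimit P X f L)
    (hg : HasMeshLimit P X g M) (h : ∀ y, ‖f y‖ ≤ g y) : ‖L‖ ≤ M := by
  refine le_of_tendsto_of_tendsto' hf.tendsto.norm hg.tendsto fun n => ?_
  rw [norm_smul, Real.norm_of_nonneg (by positivity), smul_eq_mul]
  gcongr
  exact norm_integral_le_of_norm_le (hg.integrable n) (ae_of_all _ fun ω => h _)

lemma le {f g : ℝ → ℝ} {L M : ℝ} (hf : HasMeshLimit P X f L)
    (hg : HasMeshLimit P X g M) (h : ∀ y, f y ≤ g y) : L ≤ M := by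
  refine le_of_tendsto_of_tendsto' hf.tendsto hg.tendsto fun n => ?_
  rw [smul_eq_mul, smul_eq_mul]
  gcongr
  · exact hf.integrable n
  · exact hg.integrable n
  · exact fun ω => h _

end HasMeshLimit

lemma tendsto_mesh_zero : Tendsto (fun n : ℕ => ((1 / (n + 1) : ℝ≥0) : ℝ)) atTop (𝓝 0) := by
  simpa using tendsto_one_div_add_atTop_nhds_zero_nat (𝕜 := ℝ)

namespace IsLevyProcess

variable [IsProbabilityMeasure P] {w : ℝ}

lemma hasMeshLimit_cexp (hX : IsLevyProcess P X) (hpos : HasOnlyPositiveJumps P X) (hw : 0 ≤ w)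
    {u : ℝ} {ψ : ℂ} (hψ : ∀ t : ℝ≥0,
      ∫ ω, Complex.exp (-((w + u * Complex.I) * X t ω)) ∂P = Complex.exp (t * ψ)) :
    HasMeshLimit P X (fun y => Complex.exp (-((w + u * Complex.I) * y)) - 1) ψ := by
  have hi : ∀ t, Integrable (fun ω => Complex.exp (-((w + u * Complex.I) * X t ω))) P := by
    intro t
    have := hX.measurable t
    refine (hX.integrable_exp hpos hw t).mono' (Measurable.aestronglyMeasurable (by fun_prop))
      (ae_of_all _ fun ω => ?_)
    rw [Complex.norm_exp]; simp
  refine ⟨fun n => (hi _).sub (integrable_const _), (tendsto_mul_cexp_sub_one ψ).congr fun n => ?_⟩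
  rw [integral_sub (hi _) (integrable_const _), hψ, Complex.real_smul]
  simp

lemma hasMeshLimit_exp (hX : IsLevyProcess P X) (hpos : HasOnlyPositiveJumps P X) (hw : 0 ≤ w) :
    HasMeshLimit P X (fun y => Real.exp (-w * y) - 1) (laplaceExponent P X w) := by
  have h := (hX.hasMeshLimit_cexp hpos hw (u := 0) (ψ := (laplaceExponent P X w : ℂ))
    fun t => ?_).clm_comp Complex.reCLM
  · refine (congrArg₂ (HasMeshLimit P X) (funext fun y => ?_) ?_).mp h
    · have : Complex.exp (-(((w : ℂ) + ((0 : ℝ) : ℂ) * Complex.I) * y)) =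
          ((Real.exp (-w * y) : ℝ) : ℂ) := by push_cast; simp
      rw [this]; simp only [Complex.reCLM_apply, Complex.sub_re, Complex.ofReal_re, Complex.one_re]
    · simp
  · rw [← Complex.ofReal_mul, ← Complex.ofReal_exp, ← hX.integral_exp_eq hpos hw,
      ← integral_complex_ofReal]
    congr 1; ext ω; push_cast; simp

lemma hasMeshLimit_mul_exp (hX : IsLevyProcess P X) (hpos : HasOnlyPositiveJumps P X)
    (hw : 0 < w) : HasMeshLimit P X (fun y => y * Real.exp (-w * y))
      (-deriv (laplaceExponent P X) w) := by
  refine ⟨fun n => by simpa using hX.integrable_pow_mul_exp hpos (1 / (n + 1)) hw 1, ?_⟩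
  have hc : Continuous fun s : ℝ => -deriv (laplaceExponent P X) w *
      Real.exp (s * laplaceExponent P X w) := by fun_prop
  have := (hc.tendsto 0).comp tendsto_mesh_zero
  simp only [zero_mul, Real.exp_zero, mul_one] at this
  refine this.congr fun n => ?_
  rw [hX.integral_mul_exp hpos _ hw]
  have hn : (n : ℝ) + 1 ≠ 0 := by positivity
  simp only [Function.comp, smul_eq_mul]
  push_cast
  field_simp

/-- The weighted second moment at time t is tφ''(w) up to O(t²): the squared mean and the
normalising exponential disappear in the limit. -/
lemma hasMeshLimit_sq_mul_exp (hX : IsLevyProcess P X) (hpos : HasOnlyPositiveJumps P X)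
    (hw : 0 < w) : HasMeshLimit P X (fun y => y ^ 2 * Real.exp (-w * y))
      (deriv (deriv (laplaceExponent P X)) w) := by
  refine ⟨fun n => hX.integrable_pow_mul_exp hpos (1 / (n + 1)) hw 2, ?_⟩
  have hc : Continuous fun s : ℝ => (deriv (deriv (laplaceExponent P X)) w +
      s * deriv (laplaceExponent P X) w ^ 2) * Real.exp (s * laplaceExponent P X w) := by fun_prop
  have := (hc.tendsto 0).comp tendsto_mesh_zero
  simp only [zero_mul, Real.exp_zero, mul_one, add_zero] at this
  refine this.congr fun n => ?_
  rw [hX.integral_sq_mul_exp hpos _ hw]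
  have hn : (n : ℝ) + 1 ≠ 0 := by positivity
  simp only [Function.comp, smul_eq_mul]
  push_cast
  field_simp

lemma hasMeshLimit_indicator (hX : IsLevyProcess P X) (hpos : HasOnlyPositiveJumps P X) {δ : ℝ}
    (hδ : 0 < δ) : HasMeshLimit P X ((Set.Iio (-δ)).indicator fun _ => (1 : ℝ)) 0 := by
  have hm := hX.measurable
  refine ⟨fun n => (Integrable.of_bound (C := 1)
    (((measurable_const.indicator measurableSet_Iio).comp (hm _)).aestronglyMeasurable)
    (ae_of_all _ fun ω => ?_)), (hX.tendsto_mul_measureReal_lt hpos hδ).congr fun n => ?_⟩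
  · simp only [Set.indicator]; split_ifs <;> simp
  · have h : ∀ ω, (Set.Iio (-δ)).indicator (fun _ => (1 : ℝ)) (X (1 / (n + 1)) ω) =
        {ω | X (1 / (n + 1)) ω < -δ}.indicator (fun _ => (1 : ℝ)) ω := fun ω => rfl
    simp_rw [h]
    rw [integral_indicator (measurableSet_lt (hm _) measurable_const)]
    simp

/-- Large negative increments are negligible, even when weighted exponentially. -/
lemma hasMeshLimit_negative_tail (hX : IsLevyProcess P X) (hpos : HasOnlyPositiveJumps P X)
    (hw : 0 < w) {δ : ℝ} (hδ : 0 < δ) : HasMeshLimit P X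
      ((Set.Iio (-δ)).indicator fun y => (y ^ 2 + |y| ^ 3) * Real.exp (-w * y)) 0 := by
  have hm := hX.measurable
  set f : ℝ → ℝ := (Set.Iio (-δ)).indicator fun y => (y ^ 2 + |y| ^ 3) * Real.exp (-w * y) with hf
  have hf0 : ∀ y, 0 ≤ f y := fun y => Set.indicator_nonneg (fun y _ => by positivity) y
  have hfm : Measurable f := Measurable.indicator (by fun_prop) measurableSet_Iio
  -- On [-R,-δ) the weight is bounded and the indicator has limit 0. Below -R, the shift from w to w
  -- + 2 pays once for 1 + |y| ≤ exp|y| and once for the factor exp(-R), which is later made small.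
  have hb : ∀ R : ℝ, 0 < R → ∀ y, f y ≤ (R ^ 2 + R ^ 3) * Real.exp (w * R) *
      (Set.Iio (-δ)).indicator (fun _ => (1 : ℝ)) y +
      2 * Real.exp (-R) * (y ^ 2 * Real.exp (-(w + 2) * y)) := by
    intro R hR y
    rw [hf]
    by_cases hy : y ∈ Set.Iio (-δ)
    · rw [Set.indicator_of_mem hy, Set.indicator_of_mem hy, mul_one]
      have hy0 : y < 0 := by have := Set.mem_Iio.1 hy; linarith
      rw [abs_of_neg hy0]
      rcases le_or_gt (-y) R with h | h
      · have h1 : (y ^ 2 + (-y) ^ 3) * Real.exp (-w * y) ≤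
            (R ^ 2 + R ^ 3) * Real.exp (w * R) := by
          have h2 : y ^ 2 ≤ R ^ 2 := by rw [← neg_sq]; gcongr; linarith
          have h3 : (-y) ^ 3 ≤ R ^ 3 := by gcongr; linarith
          have h4 : -w * y ≤ w * R := by nlinarith
          have h5 : 0 ≤ (-y) ^ 3 := pow_nonneg (by linarith) 3
          gcongr
        have : 0 ≤ 2 * Real.exp (-R) * (y ^ 2 * Real.exp (-(w + 2) * y)) := by positivity
        linarith
      · have h1 : (y ^ 2 + (-y) ^ 3) * Real.exp (-w * y) ≤
            2 * Real.exp (-R) * (y ^ 2 * Real.exp (-(w + 2) * y)) := by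
          have h2 : 1 + -y ≤ Real.exp (-y) := by linarith [Real.add_one_le_exp (-y)]
          have h3 : Real.exp (-y) * Real.exp (-w * y) ≤
              Real.exp (-R) * Real.exp (-(w + 2) * y) := by
            rw [← Real.exp_add, ← Real.exp_add]
            refine Real.exp_le_exp.2 ?_
            nlinarith
          have h4 : (y ^ 2 + (-y) ^ 3) * Real.exp (-w * y) =
              y ^ 2 * ((1 + -y) * Real.exp (-w * y)) := by ring
          rw [h4]
          calc y ^ 2 * ((1 + -y) * Real.exp (-w * y))
              ≤ y ^ 2 * (Real.exp (-y) * Real.exp (-w * y)) := by gcongr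
            _ ≤ y ^ 2 * (Real.exp (-R) * Real.exp (-(w + 2) * y)) := by gcongr
            _ ≤ _ := by
              have : 0 ≤ y ^ 2 * (Real.exp (-R) * Real.exp (-(w + 2) * y)) := by positivity
              linarith
        have : 0 ≤ (R ^ 2 + R ^ 3) * Real.exp (w * R) := by positivity
        linarith
    · rw [Set.indicator_of_notMem hy, Set.indicator_of_notMem hy]
      positivity
  have hlim : ∀ R : ℝ, HasMeshLimit P X (fun y => (R ^ 2 + R ^ 3) * Real.exp (w * R) *
      (Set.Iio (-δ)).indicator (fun _ => (1 : ℝ)) y +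
      2 * Real.exp (-R) * (y ^ 2 * Real.exp (-(w + 2) * y)))
      (2 * Real.exp (-R) * deriv (deriv (laplaceExponent P X)) (w + 2)) := fun R => by
    simpa using ((hX.hasMeshLimit_indicator hpos hδ).const_mul _).add
      ((hX.hasMeshLimit_sq_mul_exp hpos (w := w + 2) (by linarith)).const_mul (2 * Real.exp (-R)))
  have hi : ∀ n : ℕ, Integrable (fun ω => f (X (1 / (n + 1)) ω)) P := fun n =>
    ((hlim 1).integrable n).mono' (hfm.comp (hm _)).aestronglyMeasurable (ae_of_all _ fun ω => by
      rw [Real.norm_of_nonneg (hf0 _)]; exact hb 1 one_pos _)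
  refine ⟨hi, ?_⟩
  have h0 : ∀ n : ℕ, 0 ≤ ((n : ℝ) + 1) • ∫ ω, f (X (1 / (n + 1)) ω) ∂P := fun n =>
    smul_nonneg (by positivity) (integral_nonneg fun ω => hf0 _)
  rw [Metric.tendsto_nhds]
  intro ε hε
  have hR : Tendsto (fun R : ℝ => 2 * Real.exp (-R) *
      deriv (deriv (laplaceExponent P X)) (w + 2)) atTop (𝓝 0) := by
    have := ((Real.tendsto_exp_atBot.comp tendsto_neg_atTop_atBot).const_mul 2).mul_const
      (deriv (deriv (laplaceExponent P X)) (w + 2))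
    simpa using this
  obtain ⟨R, hRε, hR0⟩ := ((hR.eventually_lt_const hε).and (eventually_gt_atTop 0)).exists
  filter_upwards [(hlim R).tendsto.eventually_lt_const hRε] with n hn
  rw [Real.dist_eq, sub_zero, abs_of_nonneg (h0 n)]
  refine lt_of_le_of_lt ?_ hn
  rw [smul_eq_mul, smul_eq_mul]
  gcongr
  · exact hi n
  · exact (hlim R).integrable n
  · exact fun ω => hb R hR0 _

end IsLevyProcess

end MeshLimit

/-! ### Decay and Taylor expansion of the exponent on vertical lines. -/

section ExponentEstimates

variable {Ω : Type*} [MeasurableSpace Ω] {P : Measure Ω} {X : ℝ≥0 → Ω → ℝ}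

lemma norm_cexp_neg_mul_I_sub_taylor_le (x : ℝ) :
    ‖Complex.exp (-(x * Complex.I)) - 1 + x * Complex.I + x ^ 2 / 2‖ ≤ 4 * |x| ^ 3 := by
  rcases le_or_gt |x| 1 with h | h
  · have h1 := Complex.norm_exp_sub_sum_le_norm_mul_exp (-((x : ℂ) * Complex.I)) 3
    have h2 : ‖-((x : ℂ) * Complex.I)‖ = |x| := by simp
    rw [h2] at h1
    have h3 : Complex.exp (-(x * Complex.I)) - 1 + x * Complex.I + x ^ 2 / 2 =
        Complex.exp (-(x * Complex.I)) -
          ∑ m ∈ Finset.range 3, (-((x : ℂ) * Complex.I)) ^ m / (m.factorial : ℂ) := by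
      simp only [Finset.sum_range_succ, Finset.sum_range_zero, Nat.factorial]
      have hI : (-((x : ℂ) * Complex.I)) ^ 2 = -(x : ℂ) ^ 2 := by
        rw [neg_sq, mul_pow, Complex.I_sq]; ring
      rw [hI]; push_cast; ring
    rw [h3]
    have h4 : Real.exp |x| ≤ 4 := by
      calc Real.exp |x| ≤ Real.exp 1 := Real.exp_le_exp.2 h
        _ ≤ 4 := by linarith [Real.exp_one_lt_d9]
    calc _ ≤ |x| ^ 3 * Real.exp |x| := h1
      _ ≤ |x| ^ 3 * 4 := by gcongr
      _ = _ := by ring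
  · have h1 : ‖Complex.exp (-(x * Complex.I)) - 1 + x * Complex.I + x ^ 2 / 2‖ ≤
        1 + 1 + |x| + |x| ^ 2 / 2 := by
      refine (norm_add_le _ _).trans (add_le_add ((norm_add_le _ _).trans (add_le_add
        ((norm_sub_le _ _).trans (add_le_add ?_ ?_)) ?_)) ?_)
      · exact (IsLevyProcess.norm_cexp_mul_I x).le
      · simp
      · simp
      · simp
    have h2 : |x| ≤ |x| ^ 3 := le_self_pow₀ h.le (by norm_num)
    have h3 : |x| ^ 2 ≤ |x| ^ 3 := pow_le_pow_right₀ h.le (by norm_num)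
    linarith

namespace IsLevyProcess

variable [IsProbabilityMeasure P]

/-- Decay of the real part of the exponent along vertical lines, in terms of the second derivative
at a large point. -/
lemma sub_re_exponent_ge (hX : IsLevyProcess P X) (hpos : HasOnlyPositiveJumps P X)
    {w x r u : ℝ} (hw : 0 < w) (hx : 0 < x) (hr : 0 < r) (hu : |u| * r ≤ 1) (hwr : w * r ≤ 1)
    {ψ : ℂ} (hψ : ∀ t : ℝ≥0,
      ∫ ω, Complex.exp (-((w + u * Complex.I) * X t ω)) ∂P = Complex.exp (t * ψ)) :
    u ^ 2 / 40 * (deriv (deriv (laplaceExponent P X)) x -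
      Real.exp (-(x * r / 2)) * deriv (deriv (laplaceExponent P X)) (x / 2)) ≤
      laplaceExponent P X w - ψ.re := by
  set δ := min r (1 / x) with hδ
  have hδ0 : 0 < δ := lt_min hr (by positivity)
  have hδr : δ ≤ r := min_le_left _ _
  have hδx : x * δ ≤ 1 := by
    calc x * δ ≤ x * (1 / x) := by gcongr; exact min_le_right _ _
      _ = 1 := by field_simp
  have hlow := (((hX.hasMeshLimit_sq_mul_exp hpos hx).sub
    ((hX.hasMeshLimit_sq_mul_exp hpos (w := x / 2) (by positivity)).const_mul
      (Real.exp (-(x * r / 2))))).sub (hX.hasMeshLimit_negative_tail hpos hx hδ0)).const_mul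
        (u ^ 2 / 40)
  have hup := (hX.hasMeshLimit_exp hpos hw.le).sub
    ((hX.hasMeshLimit_cexp hpos hw.le hψ).clm_comp Complex.reCLM)
  rw [sub_zero] at hlow
  -- On [-δ, r] one has 1 - cos(uy) ≥ (uy)²/5, while exp(-xy) ≤ e ≤ 8e⁻¹ ≤ 8exp(-wy); hence 40 =
  -- 5·8. For y > r the term at x/2 makes the left side nonpositive, and for y < -δ the tail term
  -- does.
  refine hlow.le hup fun y => ?_
  have hre : Complex.reCLM (Complex.exp (-((w + u * Complex.I) * y)) - 1) =
      Real.exp (-w * y) * Real.cos (u * y) - 1 := by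
    rw [Complex.reCLM_apply, Complex.sub_re, Complex.exp_re]
    simp
  rw [hre]
  have hcos : 0 ≤ 1 - Real.cos (u * y) := by linarith [Real.cos_le_one (u * y)]
  have hR : Real.exp (-w * y) - 1 - (Real.exp (-w * y) * Real.cos (u * y) - 1) =
      Real.exp (-w * y) * (1 - Real.cos (u * y)) := by ring
  rw [hR]
  have hR0 : 0 ≤ Real.exp (-w * y) * (1 - Real.cos (u * y)) :=
    mul_nonneg (Real.exp_pos _).le hcos
  have hu40 : 0 ≤ u ^ 2 / 40 := by positivity
  by_cases hy : y ∈ Set.Iio (-δ)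
  · rw [Set.indicator_of_mem hy]
    refine le_trans (mul_nonpos_of_nonneg_of_nonpos hu40 ?_) hR0
    have h1 : 0 ≤ Real.exp (-(x * r / 2)) * (y ^ 2 * Real.exp (-(x / 2) * y)) := by positivity
    have h2 : 0 ≤ |y| ^ 3 * Real.exp (-x * y) := by positivity
    linarith
  · rw [Set.indicator_of_notMem hy, sub_zero]
    rcases le_or_gt y r with h | h
    · have hyδ : -δ ≤ y := by simpa using hy
      have hyr : |y| ≤ r := abs_le.2 ⟨by linarith, h⟩
      have h1 : (u * y) ^ 2 / 5 ≤ 1 - Real.cos (u * y) := by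
        refine sq_div_five_le_one_sub_cos ?_
        rw [abs_mul]
        exact (mul_le_mul_of_nonneg_left hyr (abs_nonneg u)).trans hu
      have h2 : Real.exp (-1) ≤ Real.exp (-w * y) := Real.exp_le_exp.2 (by nlinarith)
      have h3 : Real.exp (-x * y) ≤ Real.exp 1 := Real.exp_le_exp.2 (by nlinarith)
      have h4 : 0 ≤ Real.exp (-(x * r / 2)) * (y ^ 2 * Real.exp (-(x / 2) * y)) := by positivity
      have h5 : Real.exp 1 / 8 ≤ Real.exp (-1) := by
        rw [Real.exp_neg, div_le_iff₀ (by norm_num), ← div_eq_inv_mul,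
          le_div_iff₀ (Real.exp_pos 1)]
        nlinarith [Real.exp_one_lt_d9, Real.exp_pos 1]
      calc u ^ 2 / 40 * (y ^ 2 * Real.exp (-x * y) -
            Real.exp (-(x * r / 2)) * (y ^ 2 * Real.exp (-(x / 2) * y)))
          ≤ u ^ 2 / 40 * (y ^ 2 * Real.exp (-x * y)) := by gcongr; linarith
        _ ≤ u ^ 2 / 40 * (y ^ 2 * Real.exp 1) := by gcongr
        _ = (Real.exp 1 / 8) * ((u * y) ^ 2 / 5) := by ring
        _ ≤ Real.exp (-w * y) * (1 - Real.cos (u * y)) :=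
          mul_le_mul (h5.trans h2) h1 (by positivity) (Real.exp_pos _).le
    · refine le_trans (mul_nonpos_of_nonneg_of_nonpos hu40 ?_) hR0
      have h1 : Real.exp (-x * y) ≤ Real.exp (-(x * r / 2)) * Real.exp (-(x / 2) * y) := by
        rw [← Real.exp_add]
        exact Real.exp_le_exp.2 (by nlinarith)
      have := mul_le_mul_of_nonneg_left h1 (sq_nonneg y)
      linarith

/-- Third order Taylor estimate of the exponent along vertical lines. -/
lemma norm_exponent_sub_taylor_le (hX : IsLevyProcess P X) (hpos : HasOnlyPositiveJumps P X)
    {w u : ℝ} (hw : 0 < w) {ψ : ℂ} (hψ : ∀ t : ℝ≥0,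
      ∫ ω, Complex.exp (-((w + u * Complex.I) * X t ω)) ∂P = Complex.exp (t * ψ)) :
    ‖ψ - laplaceExponent P X w - u * Complex.I * deriv (laplaceExponent P X) w +
      u ^ 2 / 2 * deriv (deriv (laplaceExponent P X)) w‖ ≤
      8 / w * |u| ^ 3 * deriv (deriv (laplaceExponent P X)) (w / 2) := by
  have hlim := (((hX.hasMeshLimit_cexp hpos hw.le hψ).sub
    ((hX.hasMeshLimit_exp hpos hw.le).clm_comp Complex.ofRealCLM)).add
    ((hX.hasMeshLimit_mul_exp hpos hw).clm_comp
      ((u * Complex.I) • Complex.ofRealCLM))).add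
    ((hX.hasMeshLimit_sq_mul_exp hpos hw).clm_comp (((u : ℂ) ^ 2 / 2) • Complex.ofRealCLM))
  -- The cubic remainder splits three ways: on y ≥ 0, y exp(-wy/2) ≤ 2/w trades one power of y for
  -- φ''(w/2); on [-δ,0) it costs δφ''(w); below -δ it is negligible. Finally δ → 0.
  have hbd : ∀ δ : ℝ, 0 < δ → ‖ψ - laplaceExponent P X w -
      u * Complex.I * deriv (laplaceExponent P X) w +
      u ^ 2 / 2 * deriv (deriv (laplaceExponent P X)) w‖ ≤
      4 * |u| ^ 3 * (2 / w * deriv (deriv (laplaceExponent P X)) (w / 2) +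
        δ * deriv (deriv (laplaceExponent P X)) w) := by
    intro δ hδ
    have hup := ((((hX.hasMeshLimit_sq_mul_exp hpos (w := w / 2) (by positivity)).const_mul
      (2 / w)).add ((hX.hasMeshLimit_sq_mul_exp hpos hw).const_mul δ)).add
        (hX.hasMeshLimit_negative_tail hpos hw hδ)).const_mul (4 * |u| ^ 3)
    rw [add_zero] at hup
    refine le_trans (le_of_eq ?_) (hlim.norm_le hup fun y => ?_)
    · congr 1
      simp
      ring
    · have h1 : Complex.exp (-((w + u * Complex.I) * y)) - 1 -
          Complex.ofRealCLM (Real.exp (-w * y) - 1) +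
          ((u * Complex.I) • Complex.ofRealCLM) (y * Real.exp (-w * y)) +
          (((u : ℂ) ^ 2 / 2) • Complex.ofRealCLM) (y ^ 2 * Real.exp (-w * y)) =
          ((Real.exp (-w * y) : ℝ) : ℂ) * (Complex.exp (-((u * y : ℝ) * Complex.I)) - 1 +
            (u * y : ℝ) * Complex.I + ((u * y : ℝ) : ℂ) ^ 2 / 2) := by
        have h2 : Complex.exp (-((w + u * Complex.I) * y)) =
            ((Real.exp (-w * y) : ℝ) : ℂ) * Complex.exp (-((u * y : ℝ) * Complex.I)) := by
          rw [Complex.ofReal_exp, ← Complex.exp_add]; push_cast; congr 1; ring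
        rw [h2]
        simp only [smul_apply, Complex.ofRealCLM_apply, smul_eq_mul]
        push_cast
        ring
      rw [h1, norm_mul, Complex.norm_real, Real.norm_of_nonneg (Real.exp_pos _).le]
      have h2 := norm_cexp_neg_mul_I_sub_taylor_le (u * y)
      have h3 : |y| ^ 3 * Real.exp (-w * y) ≤ 2 / w * (y ^ 2 * Real.exp (-(w / 2) * y)) +
          δ * (y ^ 2 * Real.exp (-w * y)) +
          (Set.Iio (-δ)).indicator (fun y => (y ^ 2 + |y| ^ 3) * Real.exp (-w * y)) y := by
        have e1 : 0 ≤ 2 / w * (y ^ 2 * Real.exp (-(w / 2) * y)) := by positivity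
        have e2 : 0 ≤ δ * (y ^ 2 * Real.exp (-w * y)) := by positivity
        by_cases hy : y ∈ Set.Iio (-δ)
        · rw [Set.indicator_of_mem hy]
          have : 0 ≤ y ^ 2 * Real.exp (-w * y) := by positivity
          linarith
        · rw [Set.indicator_of_notMem hy, add_zero]
          have hyδ : -δ ≤ y := by simpa using hy
          rcases le_or_gt 0 y with h0 | h0
          · have h4 : y * Real.exp (-(w / 2) * y) ≤ 2 / w := by
              have h5 : w / 2 * y ≤ Real.exp (w / 2 * y) := by
                linarith [Real.add_one_le_exp (w / 2 * y)]
              rw [neg_mul, Real.exp_neg, ← div_eq_mul_inv, div_le_div_iff₀ (Real.exp_pos _) hw]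
              linarith
            have h6 : |y| ^ 3 * Real.exp (-w * y) =
                (y * Real.exp (-(w / 2) * y)) * (y ^ 2 * Real.exp (-(w / 2) * y)) := by
              rw [abs_of_nonneg h0, show -w * y = -(w / 2) * y + -(w / 2) * y by ring,
                Real.exp_add]
              ring
            rw [h6]
            have := mul_le_mul_of_nonneg_right h4
              (show 0 ≤ y ^ 2 * Real.exp (-(w / 2) * y) by positivity)
            linarith
          · have h4 : |y| ≤ δ := by rw [abs_of_neg h0]; linarith
            have h6 : |y| ^ 3 * Real.exp (-w * y) = |y| * (y ^ 2 * Real.exp (-w * y)) := by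
              rw [← sq_abs y]; ring
            rw [h6]
            have := mul_le_mul_of_nonneg_right h4
              (show 0 ≤ y ^ 2 * Real.exp (-w * y) by positivity)
            linarith
      calc _ ≤ Real.exp (-w * y) * (4 * |u * y| ^ 3) := by gcongr
        _ = 4 * |u| ^ 3 * (|y| ^ 3 * Real.exp (-w * y)) := by rw [abs_mul, mul_pow]; ring
        _ ≤ _ := by gcongr
  have hlim2 : Tendsto (fun δ : ℝ => 4 * |u| ^ 3 *
      (2 / w * deriv (deriv (laplaceExponent P X)) (w / 2) +
        δ * deriv (deriv (laplaceExponent P X)) w)) (𝓝[>] 0)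
      (𝓝 (8 / w * |u| ^ 3 * deriv (deriv (laplaceExponent P X)) (w / 2))) := by
    have hc : Continuous (fun δ : ℝ => 4 * |u| ^ 3 *
      (2 / w * deriv (deriv (laplaceExponent P X)) (w / 2) +
        δ * deriv (deriv (laplaceExponent P X)) w)) := by fun_prop
    have := (hc.tendsto 0).mono_left (nhdsWithin_le_nhds (s := Set.Ioi 0))
    convert this using 2
    ring
  exact ge_of_tendsto hlim2 (by filter_upwards [self_mem_nhdsWithin] with δ hδ using hbd δ hδ)

end IsLevyProcess

/-- For w > 2x₀ this is scaling by 2 from w/2. On (x₀, 2x₀] the point w/2 is not above the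
threshold, and compactness with continuity and positivity takes over. -/
lemma WeakLowerScaling.exists_half_le {a c x₀ : ℝ} {f : ℝ → ℝ} (h : WeakLowerScaling a c x₀ f)
    (hc : 0 < c) (hx₀ : 0 ≤ x₀) (hf : ∀ x, 0 < x → 0 < f x) (hfc : ∀ x, 0 < x → ContinuousAt f x) :
    ∃ D : ℝ, 0 < D ∧ ∀ w, x₀ < w → f (w / 2) ≤ D * f w := by
  set D₁ := (c * (2 : ℝ) ^ a)⁻¹ with hD₁
  have hD₁0 : 0 < D₁ := by positivity
  have hbig : ∀ w, 2 * x₀ < w → f (w / 2) ≤ D₁ * f w := by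
    intro w hw
    have h1 := h 2 (w / 2) one_le_two (by linarith)
    rw [mul_div_cancel₀ w two_ne_zero] at h1
    rw [hD₁, inv_mul_eq_div, le_div_iff₀ (by positivity)]
    linarith
  rcases hx₀.eq_or_lt with rfl | hx₀
  · exact ⟨D₁, hD₁0, fun w hw => hbig w (by linarith)⟩
  · have hcont : ContinuousOn (fun w => f (w / 2) / f w) (Set.Icc x₀ (2 * x₀)) := by
      intro w hw
      have hw0 : 0 < w := hx₀.trans_le hw.1
      refine ContinuousAt.continuousWithinAt (ContinuousAt.div ?_ (hfc w hw0) (hf w hw0).ne')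
      exact ContinuousAt.comp (f := fun w : ℝ => w / 2) (hfc _ (by positivity)) (by fun_prop)
    obtain ⟨M, hM⟩ := isCompact_Icc.bddAbove_image hcont
    refine ⟨max D₁ M, lt_max_of_lt_left hD₁0, fun w hw => ?_⟩
    have hfw := hf w (hx₀.trans hw)
    rcases lt_or_ge (2 * x₀) w with h2 | h2
    · exact (hbig w h2).trans (by gcongr; exact le_max_left _ _)
    · have := hM ⟨w, ⟨hw.le, h2⟩, rfl⟩
      simp only at this
      rw [div_le_iff₀ hfw] at this
      exact this.trans (by gcongr; exact le_max_right _ _)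

/-- Under weak lower scaling of the second derivative, the real part of the exponent decays along
vertical lines at a polynomial rate. -/
lemma IsSpectrallyPositiveOfUnboundedVariation.exists_sub_re_exponent_ge [IsProbabilityMeasure P]
    (hX : IsSpectrallyPositiveOfUnboundedVariation P X) {α c x₀ : ℝ} (hc : 0 < c)
    (hx₀ : 0 ≤ x₀)
    (hscal : WeakLowerScaling (α - 2) c x₀ (deriv (deriv (laplaceExponent P X)))) :
    ∃ κ : ℝ, 0 < κ ∧ ∀ w u : ℝ, x₀ < w → ∀ ψ : ℂ, (∀ t : ℝ≥0,
      ∫ ω, Complex.exp (-((w + u * Complex.I) * X t ω)) ∂P = Complex.exp (t * ψ)) →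
      κ * u ^ 2 * max 1 (|u| / w) ^ (min α 2 - 2) * deriv (deriv (laplaceExponent P X)) w ≤
        laplaceExponent P X w - ψ.re := by
  set f := deriv (deriv (laplaceExponent P X)) with hf
  have hfpos : ∀ x, 0 < x → 0 < f x := fun x hx => hX.deriv_deriv_laplaceExponent_pos hx
  set a := α - 2 with ha
  set θ := c * (2 : ℝ) ^ a with hθ
  have hθ0 : 0 < θ := by positivity
  -- With x = Bm and r = 1/m, scaling by 2 gives θ f(Bm/2) ≤ f(Bm), so the subtracted term is at
  -- most f(Bm)/2. B ≥ 2 keeps Bm/2 above x₀.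
  obtain ⟨B, hB2, hBe⟩ : ∃ B : ℝ, 2 ≤ B ∧ Real.exp (-(B / 2)) ≤ θ / 2 := by
    have h1 : Tendsto (fun B : ℝ => Real.exp (-(B / 2))) atTop (𝓝 0) :=
      Real.tendsto_exp_atBot.comp (tendsto_neg_atTop_atBot.comp
        (tendsto_id.atTop_div_const two_pos))
    obtain ⟨B, h2, h3⟩ := ((h1.eventually_lt_const (half_pos hθ0)).and
      (eventually_ge_atTop 2)).exists
    exact ⟨B, h3, h2.le⟩
  have hB0 : 0 < B := by linarith
  refine ⟨c ^ 2 * B ^ a / 80, by positivity, fun w u hw ψ hψ => ?_⟩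
  have hw0 : 0 < w := hx₀.trans_lt hw
  set m := max w |u| with hm
  have hm0 : 0 < m := lt_max_of_lt_left hw0
  have hwm : w ≤ m := le_max_left _ _
  have hum : |u| ≤ m := le_max_right _ _
  have h1 := hX.levy.sub_re_exponent_ge hX.only_positive_jumps (x := B * m) (r := 1 / m) hw0
    (by positivity) (by positivity) (by rw [mul_one_div]; exact div_le_one_of_le₀ hum hm0.le)
    (by rw [mul_one_div]; exact div_le_one_of_le₀ hwm hm0.le) hψ
  rw [← hf, show B * m * (1 / m) / 2 = B / 2 by field_simp] at h1
  have h2 : θ * f (B * m / 2) ≤ f (B * m) := by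
    have := hscal 2 (B * m / 2) one_le_two (by nlinarith)
    rwa [mul_div_cancel₀ _ two_ne_zero] at this
  have hf2 : 0 < f (B * m / 2) := hfpos _ (by positivity)
  have h3 : Real.exp (-(B / 2)) * f (B * m / 2) ≤ f (B * m) / 2 := by
    have := mul_le_mul_of_nonneg_right hBe hf2.le
    linarith
  have h4 : c * B ^ a * f m ≤ f (B * m) := hscal B m (by linarith) (by linarith)
  have h5 : c * (m / w) ^ a * f w ≤ f m := by
    have := hscal (m / w) w ((one_le_div hw0).2 hwm) hw
    rwa [div_mul_cancel₀ _ hw0.ne'] at this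
  have hmw : m / w = max 1 (|u| / w) := by
    rw [hm, ← max_div_div_right hw0.le, div_self hw0.ne']
  -- Capping α at 2 makes the exponent nonpositive, as the monotonicity step of the saddle point
  -- estimate requires.
  have h6 : max 1 (|u| / w) ^ (min α 2 - 2) ≤ (m / w) ^ a := by
    rw [hmw]
    exact Real.rpow_le_rpow_of_exponent_le (le_max_left _ _) (by
      rw [ha]; linarith [min_le_left α 2])
  have hfw := hfpos w hw0
  calc c ^ 2 * B ^ a / 80 * u ^ 2 * max 1 (|u| / w) ^ (min α 2 - 2) * f w
      ≤ c ^ 2 * B ^ a / 80 * u ^ 2 * (m / w) ^ a * f w := by gcongr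
    _ = u ^ 2 / 80 * (c * B ^ a * (c * (m / w) ^ a * f w)) := by ring
    _ ≤ u ^ 2 / 80 * (c * B ^ a * f m) := by gcongr
    _ ≤ u ^ 2 / 80 * f (B * m) := by gcongr
    _ = u ^ 2 / 40 * (f (B * m) - f (B * m) / 2) := by ring
    _ ≤ u ^ 2 / 40 * (f (B * m) - Real.exp (-(B / 2)) * f (B * m / 2)) := by gcongr
    _ ≤ _ := h1

end ExponentEstimates

/-! ### Laplace inversion on a vertical line. -/

section Density

variable {Ω : Type*} [MeasurableSpace Ω] {P : Measure Ω} [IsProbabilityMeasure P]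
  {X : ℝ≥0 → Ω → ℝ}

lemma Complex.norm_exp_sub_exp_le {a b : ℂ} (ha : a.re ≤ 0) (hb : b.re ≤ 0) :
    ‖Complex.exp a - Complex.exp b‖ ≤ ‖a - b‖ := by
  have := (convex_halfSpace_re_le 0).norm_image_sub_le_of_norm_deriv_le (f := Complex.exp)
    (C := 1) (fun x _ => Complex.differentiableAt_exp) (fun x hx => by
      rw [Complex.deriv_exp, Complex.norm_exp]
      exact Real.exp_le_one_iff.2 hx) (x := b) (y := a) hb ha
  simpa using this

lemma integrable_exp_neg_mul_abs_rpow {b β : ℝ} (hb : 0 < b) (hβ : 0 < β) :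
    Integrable fun x : ℝ => Real.exp (-b * |x| ^ β) := by
  -- A non-integrable function has integral 0 by convention, whereas this integral is a positive
  -- Gamma value.
  refine not_imp_comm.1 integral_undef ?_
  rw [integral_comp_abs (f := fun x => Real.exp (-b * x ^ β)), integral_exp_neg_mul_rpow hβ hb]
  have : 0 < Real.Gamma (1 / β + 1) := Real.Gamma_pos_of_pos (by positivity)
  positivity

/-- This turns the two-regime decay into a single exp(-κ z^β), at the price of a factor exp(κ). -/
lemma rpow_sub_one_le_sq_mul_max_rpow {β z : ℝ} (hβ : 0 < β) (hz : 0 ≤ z) :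
    z ^ β - 1 ≤ z ^ 2 * max 1 z ^ (β - 2) := by
  rcases le_or_gt z 1 with h | h
  · have h1 : z ^ β ≤ 1 := Real.rpow_le_one hz h hβ.le
    have h2 : 0 ≤ z ^ 2 * max 1 z ^ (β - 2) := by positivity
    linarith
  · have hz0 : 0 < z := by linarith
    rw [max_eq_right h.le, ← Real.rpow_natCast z 2, ← Real.rpow_add hz0]
    have : ((2 : ℕ) : ℝ) + (β - 2) = β := by push_cast; ring
    rw [this]; linarith

namespace IsLevyProcess

lemma continuous_integral_cexp (hX : IsLevyProcess P X) (hpos : HasOnlyPositiveJumps P X) {w : ℝ}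
    (hw : 0 ≤ w) (t : ℝ≥0) :
    Continuous fun u : ℝ => ∫ ω, Complex.exp (-((w + u * Complex.I) * X t ω)) ∂P := by
  have hm := hX.measurable t
  refine continuous_of_dominated (bound := fun ω => Real.exp (-w * X t ω))
    (fun u => Measurable.aestronglyMeasurable (by fun_prop)) (fun u => ae_of_all _ fun ω => ?_)
    (hX.integrable_exp hpos hw t) (ae_of_all _ fun ω => by fun_prop)
  rw [Complex.norm_exp]; simp

/-- If the Laplace transform is integrable along a vertical line then the law has a continuous
density, given by the inversion formula on that line. -/
lemma exists_density (hX : IsLevyProcess P X) (hpos : HasOnlyPositiveJumps P X) {w : ℝ}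
    (hw : 0 ≤ w) (t : ℝ≥0)
    (hint : Integrable fun u : ℝ => ∫ ω, Complex.exp (-((w + u * Complex.I) * X t ω)) ∂P) :
    ∃ p : ℝ → ℝ, Continuous p ∧ (∀ x, 0 ≤ p x) ∧
      P.map (X t) = volume.withDensity (fun x => ENNReal.ofReal (p x)) ∧
      ∀ x, (p x : ℂ) = (1 / (2 * Real.pi)) * ∫ u : ℝ, Complex.exp ((w + u * Complex.I) * x) *
        ∫ ω, Complex.exp (-((w + u * Complex.I) * X t ω)) ∂P := by
  have hm := hX.measurable t
  have := Measure.isProbabilityMeasure_map hm.aemeasurable (μ := P)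
  set μ := P.map (X t) with hμ
  have hexpi : Integrable (fun x => Real.exp (-w * x)) μ := by
    rw [hμ, integrable_map_measure (Continuous.aestronglyMeasurable (by fun_prop)) hm.aemeasurable]
    exact hX.integrable_exp hpos hw t
  set Z := ∫ x, Real.exp (-w * x) ∂μ with hZ
  have hZ0 : 0 < Z := integral_exp_pos hexpi
  -- Up to the factor Z and a reflection of the variable, the characteristic function of ρ is the
  -- Laplace transform on the line. Its density is then multiplied by Z exp(wx) to undo the tilt.
  set ρ := μ.tilted (fun x => -w * x) with hρ
  have hρp : IsProbabilityMeasure ρ := isProbabilityMeasure_tilted hexpi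
  have hchar : ∀ v : ℝ, charFun ρ v =
      (Z : ℂ)⁻¹ * ∫ ω, Complex.exp (-((w + ((-v : ℝ) : ℂ) * Complex.I) * X t ω)) ∂P := by
    intro v
    rw [charFun_apply_real, hρ, integral_tilted, hμ, integral_map hm.aemeasurable
      (Continuous.aestronglyMeasurable (by fun_prop)), ← integral_const_mul]
    congr 1; ext ω
    rw [Complex.real_smul, ← hμ, ← hZ, Complex.ofReal_div, Complex.ofReal_exp, div_eq_inv_mul,
      mul_assoc, ← Complex.exp_add]
    congr 2; push_cast; ring
  have hci : Integrable (charFun ρ) := by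
    rw [funext hchar]
    exact (hint.comp_neg).const_mul _
  obtain ⟨q, hqc, hq0, hqd, hqf⟩ := exists_density_of_integrable_charFun ρ hci
  refine ⟨fun x => q x * (Z * Real.exp (w * x)), by fun_prop,
    fun x => mul_nonneg (hq0 x) (by positivity), ?_, fun x => ?_⟩
  · have h1 : ρ.withDensity (fun x => ENNReal.ofReal (Z * Real.exp (w * x))) = μ := by
      have h2 := withDensity_inv_same (μ := μ)
        (f := fun x => ENNReal.ofReal (Real.exp (-w * x) / Z)) (by fun_prop)
        (ae_of_all _ fun x => by
          rw [Ne, ENNReal.ofReal_eq_zero, not_le]; positivity)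
        (ae_of_all _ fun x => ENNReal.ofReal_ne_top)
      rw [← h2]
      congr 1
      ext x
      rw [← ENNReal.ofReal_inv_of_pos (by positivity), inv_div, neg_mul, Real.exp_neg,
        div_inv_eq_mul]
    rw [← h1, hqd, ← withDensity_mul _ (by fun_prop) (by fun_prop)]
    congr 1
    ext x
    rw [Pi.mul_apply, ENNReal.ofReal_mul (hq0 x)]
  · push_cast
    rw [hqf x, ← integral_neg_eq_self (fun u : ℝ => Complex.exp ((w + u * Complex.I) * x) *
        ∫ ω, Complex.exp (-((w + u * Complex.I) * X t ω)) ∂P), mul_assoc]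
    congr 1
    rw [← integral_mul_const]
    congr 1; ext u
    rw [hchar]
    have hZc : (Z : ℂ) ≠ 0 := by exact_mod_cast hZ0.ne'
    have h3 : Complex.exp ((w + ((-u : ℝ) : ℂ) * Complex.I) * x) =
        Complex.exp (-(u * x) * Complex.I) * Complex.exp (w * x) := by
      rw [← Complex.exp_add]; congr 1; push_cast; ring
    rw [h3]
    field_simp

end IsLevyProcess

/-- The integral of `min (C|v|³/√T, g v)` vanishes as `T → ∞`. -/
lemma tendsto_integral_min_zero {g : ℝ → ℝ} (hg : Integrable g) (hg0 : ∀ v, 0 ≤ g v)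
    {C : ℝ} (hC : 0 ≤ C) :
    Tendsto (fun T : ℝ => ∫ v : ℝ, min (C * |v| ^ 3 / Real.sqrt T) (g v)) atTop (𝓝 0) := by
  have : Tendsto (fun T : ℝ => ∫ v : ℝ, min (C * |v| ^ 3 / Real.sqrt T) (g v)) atTop
      (𝓝 (∫ _ : ℝ, (0 : ℝ))) := by
    refine tendsto_integral_filter_of_dominated_convergence g
      (Eventually.of_forall fun T => ?_) (Eventually.of_forall fun T => ae_of_all _ fun v => ?_)
      hg (ae_of_all _ fun v => ?_)
    · exact (Continuous.aestronglyMeasurable (by fun_prop)).inf hg.aestronglyMeasurable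
    · rw [Real.norm_of_nonneg (le_min (by positivity) (hg0 v))]; exact min_le_right _ _
    · have h1 : Tendsto (fun T : ℝ => C * |v| ^ 3 / Real.sqrt T) atTop (𝓝 0) :=
        Real.tendsto_sqrt_atTop.const_div_atTop _
      have := h1.min (tendsto_const_nhds (x := g v))
      rwa [min_eq_left (hg0 v)] at this
  simpa using this

end Density

/-! ### The saddle point estimate and its uniformity. -/

section Asymptotics

variable {Ω : Type*} [MeasurableSpace Ω] {P : Measure Ω} [IsProbabilityMeasure P]
  {X : ℝ≥0 → Ω → ℝ}

lemma eq_of_withDensity_ofReal_eq {p q : ℝ → ℝ} (hp : Continuous p) (hq : Continuous q)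
    (hp0 : ∀ x, 0 ≤ p x) (hq0 : ∀ x, 0 ≤ q x)
    (h : volume.withDensity (fun x => ENNReal.ofReal (p x)) =
      volume.withDensity (fun x => ENNReal.ofReal (q x))) : p = q := by
  rw [withDensity_eq_iff_of_sigmaFinite (by fun_prop) (by fun_prop)] at h
  refine (hp.ae_eq_iff_eq volume hq).1 ?_
  filter_upwards [h] with x hx
  exact (ENNReal.ofReal_eq_ofReal_iff (hp0 x) (hq0 x)).1 hx

/-- Integrability of the Laplace transform along a vertical line, given polynomial decay of the
real part of the exponent. -/
lemma integrable_integral_cexp_of_decay (hX : IsLevyProcess P X) (hpos : HasOnlyPositiveJumps P X)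
    {w κ β f : ℝ} (hw : 0 < w) (hκ : 0 < κ) (hβ : 0 < β) (hf : 0 < f) {Ψ : ℝ → ℂ}
    (hΨ : ∀ (u : ℝ) (t : ℝ≥0),
      ∫ ω, Complex.exp (-((w + u * Complex.I) * X t ω)) ∂P = Complex.exp (t * Ψ u))
    (hdecay : ∀ u : ℝ, κ * u ^ 2 * max 1 (|u| / w) ^ (β - 2) * f ≤
      laplaceExponent P X w - (Ψ u).re) {t : ℝ≥0} (ht : 0 < t) :
    Integrable fun u : ℝ => ∫ ω, Complex.exp (-((w + u * Complex.I) * X t ω)) ∂P := by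
  have ht' : (0 : ℝ) < t := ht
  have hb : 0 < κ * (t * w ^ 2 * f) := by positivity
  have h1 := ((integrable_exp_neg_mul_abs_rpow hb hβ).comp_div hw.ne').const_mul
    (Real.exp (t * laplaceExponent P X w + κ * (t * w ^ 2 * f)))
  refine h1.mono' (hX.continuous_integral_cexp hpos hw.le t).aestronglyMeasurable
    (ae_of_all _ fun u => ?_)
  rw [hΨ, Complex.norm_exp, ← Real.exp_add]
  refine Real.exp_le_exp.2 ?_
  have h2 := rpow_sub_one_le_sq_mul_max_rpow hβ (show 0 ≤ |u| / w by positivity)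
  have h3 := mul_le_mul_of_nonneg_left (hdecay u) ht'.le
  have h4 := mul_le_mul_of_nonneg_left h2 hb.le
  have h5 : κ * (t * w ^ 2 * f) * ((|u| / w) ^ 2 * max 1 (|u| / w) ^ (β - 2)) =
      t * (κ * u ^ 2 * max 1 (|u| / w) ^ (β - 2) * f) := by
    rw [div_pow, sq_abs]; field_simp
  rw [abs_div, abs_of_pos hw, Complex.re_ofReal_mul]
  linarith

/-- Saddle point estimate: the normalised density at the saddle point differs from one by at most
the integral of the pointwise error of the normalised integrand. -/
lemma abs_density_mul_sub_one_le {w κ β f d φ D : ℝ} {t : ℝ≥0} (hw : 0 < w) (hκ : 0 < κ)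
    (hβ : 0 < β) (hβ2 : β ≤ 2) (hf : 0 < f) (ht : 0 < t) (hT : 1 ≤ t * w ^ 2 * f) {Ψ : ℝ → ℂ}
    (hΨc : Continuous fun u => Complex.exp (t * Ψ u))
    (hdecay : ∀ u : ℝ, κ * u ^ 2 * max 1 (|u| / w) ^ (β - 2) * f ≤ φ - (Ψ u).re)
    (htaylor : ∀ u : ℝ, ‖Ψ u - φ - u * Complex.I * d + u ^ 2 / 2 * f‖ ≤ D / w * |u| ^ 3 * f)
    {y : ℝ} (hy : (y : ℂ) = (1 / (2 * Real.pi)) * ∫ u : ℝ,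
      Complex.exp ((w + u * Complex.I) * ((-t * d : ℝ) : ℂ)) * Complex.exp (t * Ψ u)) :
    |y * Real.sqrt (2 * Real.pi * t * f) * Real.exp (t * (w * d - φ)) - 1| ≤
      (Real.sqrt (2 * Real.pi))⁻¹ * ∫ v : ℝ, min (D * |v| ^ 3 / Real.sqrt (t * w ^ 2 * f))
        (Real.exp κ * Real.exp (-κ * |v| ^ β) + Real.exp (-(1 / 2) * v ^ 2)) := by
  have ht' : (0 : ℝ) < t := ht
  set s := Real.sqrt (t * f) with hs
  have hs0 : 0 < s := Real.sqrt_pos.2 (by positivity)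
  have hs2 : s ^ 2 = t * f := Real.sq_sqrt (by positivity)
  have hTs : Real.sqrt (t * w ^ 2 * f) = w * s := by
    rw [show t * w ^ 2 * f = w ^ 2 * (t * f) by ring, Real.sqrt_mul (by positivity),
      Real.sqrt_sq hw.le]
  have hws : 1 ≤ w * s := by rw [← hTs]; exact Real.one_le_sqrt.2 hT
  -- At x = -td the factor exp((w+iu)x) removes exactly the linear term of tΨ.
  set E : ℝ → ℂ := fun u => t * (Ψ u - φ - u * Complex.I * d) with hE
  set F : ℝ → ℂ := fun v => Complex.exp (E (v / s)) with hF
  have hEre : ∀ u, (E u).re = -(t * (φ - (Ψ u).re)) := fun u => by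
    simp only [hE, Complex.sub_re, Complex.ofReal_re, Complex.mul_re,
      Complex.ofReal_im, Complex.I_re, Complex.I_im, Complex.mul_im]
    ring
  have hErele : ∀ v, (E (v / s)).re ≤ -(κ * (v ^ 2 * max 1 |v| ^ (β - 2))) := by
    intro v
    rw [hEre]
    have h1 := mul_le_mul_of_nonneg_left (hdecay (v / s)) ht'.le
    -- Since ws = √T ≥ 1, |v/s|/w ≤ |v|, and β - 2 ≤ 0 reverses the order; the resulting majorant is
    -- free of t and w.
    have h2 : max 1 |v| ^ (β - 2) ≤ max 1 (|v / s| / w) ^ (β - 2) := by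
      refine Real.rpow_le_rpow_of_nonpos (by positivity) ?_ (by linarith)
      refine max_le_max le_rfl ?_
      rw [abs_div, abs_of_pos hs0, div_div, mul_comm s w]
      exact div_le_self (abs_nonneg v) hws
    have h3 : t * (κ * (v / s) ^ 2 * max 1 (|v / s| / w) ^ (β - 2) * f) =
        κ * (v ^ 2 * max 1 (|v / s| / w) ^ (β - 2)) := by
      rw [div_pow, hs2]; field_simp
    rw [h3] at h1
    have h4 : κ * (v ^ 2 * max 1 |v| ^ (β - 2)) ≤
      κ * (v ^ 2 * max 1 (|v / s| / w) ^ (β - 2)) := by gcongr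
    linarith
  have hFnorm : ∀ v, ‖F v‖ ≤ Real.exp κ * Real.exp (-κ * |v| ^ β) := by
    intro v
    rw [hF, Complex.norm_exp, ← Real.exp_add]
    refine Real.exp_le_exp.2 ((hErele v).trans ?_)
    have h1 := rpow_sub_one_le_sq_mul_max_rpow hβ (abs_nonneg v)
    rw [sq_abs] at h1
    have := mul_le_mul_of_nonneg_left h1 hκ.le
    linarith
  have hgauss : ∀ v : ℝ, Complex.exp (-((v : ℂ) ^ 2 / 2)) =
      ((Real.exp (-(1 / 2) * v ^ 2) : ℝ) : ℂ) := fun v => by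
    push_cast; congr 1; ring
  have hFdiff : ∀ v, ‖F v - ((Real.exp (-(1 / 2) * v ^ 2) : ℝ) : ℂ)‖ ≤
      min (D * |v| ^ 3 / Real.sqrt (t * w ^ 2 * f))
        (Real.exp κ * Real.exp (-κ * |v| ^ β) + Real.exp (-(1 / 2) * v ^ 2)) := by
    intro v
    refine le_min ?_ ?_
    · rw [← hgauss]
      -- Both exponents lie in the left half-plane, where exp is 1-Lipschitz, so the Taylor bound
      -- transfers directly.
      refine (Complex.norm_exp_sub_exp_le ?_ ?_).trans ?_
      · refine (hErele v).trans (neg_nonpos.2 (by positivity))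
      · rw [show -((v : ℂ) ^ 2 / 2) = ((-(v ^ 2 / 2) : ℝ) : ℂ) by push_cast; rfl,
          Complex.ofReal_re]
        exact neg_nonpos.2 (by positivity)
      · have h1 : E (v / s) - -((v : ℂ) ^ 2 / 2) = (t : ℂ) * (Ψ (v / s) - φ -
            ((v / s : ℝ) : ℂ) * Complex.I * d + ((v / s : ℝ) : ℂ) ^ 2 / 2 * f) := by
          have h2 : (t : ℂ) * (((v / s : ℝ) : ℂ) ^ 2 / 2 * f) = (v : ℂ) ^ 2 / 2 := by
            have : (t : ℝ) * ((v / s) ^ 2 / 2 * f) = v ^ 2 / 2 := by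
              rw [div_pow, hs2]; field_simp
            exact_mod_cast congrArg (fun x : ℝ => (x : ℂ)) this
          rw [mul_add, h2, hE]; ring
        rw [h1, norm_mul]
        have h3 : ‖(t : ℂ)‖ = t := by
          rw [show (t : ℂ) = (((t : ℝ)) : ℂ) from rfl, Complex.norm_real,
            Real.norm_of_nonneg ht'.le]
        rw [h3]
        calc (t : ℝ) * _ ≤ t * (D / w * |v / s| ^ 3 * f) := by gcongr; exact htaylor _
          _ = D * |v| ^ 3 / (w * s) := by
            rw [abs_div, abs_of_pos hs0, div_pow, show s ^ 3 = s ^ 2 * s by ring, hs2]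
            field_simp
          _ = _ := by rw [hTs]
    · refine (norm_sub_le _ _).trans (add_le_add (hFnorm v) ?_)
      rw [Complex.norm_real, Real.norm_of_nonneg (Real.exp_pos _).le]
  have hg1 : Integrable fun v : ℝ => Real.exp κ * Real.exp (-κ * |v| ^ β) :=
    (integrable_exp_neg_mul_abs_rpow hκ hβ).const_mul _
  have hg2 : Integrable fun v : ℝ => Real.exp (-(1 / 2) * v ^ 2) :=
    integrable_exp_neg_mul_sq (by norm_num)
  have hFeq : ∀ u, Complex.exp (E u) = Complex.exp (t * Ψ u) *
      Complex.exp (-(t * (φ + u * Complex.I * d))) := fun u => by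
    rw [← Complex.exp_add]; congr 1; rw [hE]; ring
  have hFc : Continuous F := by
    have h1 : Continuous fun u => Complex.exp (E u) := by
      rw [funext hFeq]; fun_prop
    exact h1.comp (by fun_prop)
  have hFi : Integrable F := hg1.mono' hFc.aestronglyMeasurable (ae_of_all _ hFnorm)
  have hmain : ((y * Real.sqrt (2 * Real.pi * t * f) * Real.exp (t * (w * d - φ)) - 1 : ℝ) : ℂ) =
      ((Real.sqrt (2 * Real.pi))⁻¹ : ℝ) *
        ∫ v : ℝ, (F v - ((Real.exp (-(1 / 2) * v ^ 2) : ℝ) : ℂ)) := by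
    have h2pi : 0 < Real.sqrt (2 * Real.pi) := Real.sqrt_pos.2 (by positivity)
    have hsq : Real.sqrt (2 * Real.pi) ^ 2 = 2 * Real.pi := Real.sq_sqrt (by positivity)
    have hg2c : Integrable fun v : ℝ => ((Real.exp (-(1 / 2) * v ^ 2) : ℝ) : ℂ) := hg2.ofReal
    rw [integral_sub hFi hg2c, integral_complex_ofReal, integral_gaussian,
      mul_sub (((Real.sqrt (2 * Real.pi))⁻¹ : ℝ) : ℂ),
      show Real.pi / (1 / 2) = 2 * Real.pi by ring, ← Complex.ofReal_mul,
      inv_mul_cancel₀ h2pi.ne', Complex.ofReal_sub]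
    congr 1
    rw [hF, Measure.integral_comp_div (fun u => Complex.exp (E u)), abs_of_pos hs0,
      Complex.real_smul, Complex.ofReal_mul, Complex.ofReal_mul, hy,
      show 2 * Real.pi * t * f = 2 * Real.pi * (t * f) by ring, Real.sqrt_mul (by positivity)]
    have h3 : (∫ u : ℝ, Complex.exp ((w + u * Complex.I) * ((-t * d : ℝ) : ℂ)) *
        Complex.exp (t * Ψ u)) * ((Real.exp (t * (w * d - φ)) : ℝ) : ℂ) =
        ∫ u, Complex.exp (E u) := by
      rw [← integral_mul_const]
      congr 1; ext u
      rw [Complex.ofReal_exp, ← Complex.exp_add, ← Complex.exp_add, hE]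
      congr 1; push_cast; ring
    rw [← h3, ← hs]
    have h4 : (1 / (2 * Real.pi) : ℂ) * (Real.sqrt (2 * Real.pi) : ℂ) =
        ((Real.sqrt (2 * Real.pi))⁻¹ : ℝ) := by
      have : 1 / (2 * Real.pi) * Real.sqrt (2 * Real.pi) = (Real.sqrt (2 * Real.pi))⁻¹ := by
        field_simp
        exact hsq
      rw [← this]; push_cast; rfl
    rw [← h4]; push_cast; ring
  have hnorm := congrArg norm hmain
  rw [Complex.norm_real, Real.norm_eq_abs, norm_mul, Complex.norm_real,
    Real.norm_of_nonneg (by positivity)] at hnorm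
  rw [hnorm]
  gcongr
  refine norm_integral_le_of_norm_le ?_ (ae_of_all _ hFdiff)
  have hD : 0 ≤ D := by
    have := (norm_nonneg _).trans (htaylor 1)
    rw [abs_one, one_pow, mul_one] at this
    have h1 := nonneg_of_mul_nonneg_left this hf
    have h2 := mul_nonneg h1 hw.le
    rwa [div_mul_cancel₀ _ hw.ne'] at h2
  refine (hg1.add hg2).mono' ((Continuous.aestronglyMeasurable (by fun_prop)).inf
    (hg1.add hg2).aestronglyMeasurable) (ae_of_all _ fun v => ?_)
  rw [Real.norm_of_nonneg (by positivity)]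
  exact min_le_right _ _

end Asymptotics

/-- For every `t > 0` the law of `X_t` is absolutely continuous, with a (necessarily unique)
continuous density `p t`, and `p` satisfies the stated asymptotics. -/
theorem theorem1 {Ω : Type*} [MeasurableSpace Ω] (P : Measure Ω) [IsProbabilityMeasure P]
    (X : ℝ≥0 → Ω → ℝ) (hX : IsSpectrallyPositiveOfUnboundedVariation P X)
    (φ : ℝ → ℝ) (hφ : φ = laplaceExponent P X)
    (α c x₀ : ℝ) (hα : 0 < α) (hc : 0 < c) (hc1 : c ≤ 1) (hx₀ : 0 ≤ x₀)
    (hscal : WeakLowerScaling (α - 2) c x₀ (deriv (deriv φ))) :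
    (∀ t : ℝ≥0, 0 < t → P.map (X t) ≪ volume) ∧
    ∃ p : ℝ≥0 → ℝ → ℝ,
      (∀ t : ℝ≥0, 0 < t → Continuous (p t) ∧ (∀ x, 0 ≤ p t x) ∧
        P.map (X t) = volume.withDensity (fun x => ENNReal.ofReal (p t x))) ∧
      ∀ ε : ℝ, 0 < ε → ∃ M₀ : ℝ, 0 < M₀ ∧
        ∀ (t : ℝ≥0) (w : ℝ), 0 < t → x₀ < w → M₀ < t * w ^ 2 * deriv (deriv φ) w →
          |p t (-t * deriv φ w) * Real.sqrt (2 * Real.pi * t * deriv (deriv φ) w) *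
              Real.exp (t * (w * deriv φ w - φ w)) - 1| ≤ ε := by
  subst hφ
  have hL := hX.levy
  have hpos := hX.only_positive_jumps
  set f := deriv (deriv (laplaceExponent P X)) with hf
  have hfpos : ∀ x, 0 < x → 0 < f x := fun x hx => hX.deriv_deriv_laplaceExponent_pos hx
  obtain ⟨κ, hκ, hdecay⟩ := hX.exists_sub_re_exponent_ge hc hx₀ hscal
  obtain ⟨D, hD, hhalf⟩ := hscal.exists_half_le hc hx₀ hfpos
    fun x hx => hL.continuousAt_deriv_deriv_laplaceExponent hpos hx
  have hβ : 0 < min α 2 := lt_min hα two_pos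
  choose! Ψ hΨ using fun (w u : ℝ) (hw : 0 ≤ w) => hL.exists_integral_cexp_eq hpos hw u
  have hden : ∀ w, x₀ < w → ∀ t : ℝ≥0, 0 < t → _ := fun w hw t ht =>
    have hw0 : 0 < w := hx₀.trans_lt hw
    hL.exists_density hpos hw0.le t (integrable_integral_cexp_of_decay hL hpos hw0 hκ hβ
      (hfpos w hw0) (fun u => hΨ w u hw0.le) (fun u => hdecay w u hw _ (hΨ w u hw0.le)) ht)
  -- Any line beyond x₀ would do: continuous densities are unique, so p agrees with the inversion on
  -- each line w > x₀.
  choose! p hpc hp0 hpd hpf using hden (x₀ + 1) (by linarith)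
  refine ⟨fun t ht => ?_, p, fun t ht => ⟨hpc t ht, hp0 t ht, hpd t ht⟩, fun ε hε => ?_⟩
  · rw [hpd t ht]; exact withDensity_absolutelyContinuous _ _
  set g : ℝ → ℝ := fun v => Real.exp κ * Real.exp (-κ * |v| ^ min α 2) +
    Real.exp (-(1 / 2) * v ^ 2) with hg
  have hgi : Integrable g := ((integrable_exp_neg_mul_abs_rpow hκ hβ).const_mul _).add
    (integrable_exp_neg_mul_sq (by norm_num))
  have hlim := (tendsto_integral_min_zero hgi (fun v => by positivity)
    (show 0 ≤ 8 * D by positivity)).const_mul (Real.sqrt (2 * Real.pi))⁻¹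
  rw [mul_zero] at hlim
  obtain ⟨M, hM⟩ := eventually_atTop.1 (hlim.eventually_lt_const hε)
  -- M depends only on ε, κ, D and min(α,2), hence is uniform in t and w; the 1 supplies T ≥ 1.
  refine ⟨max M 1, lt_max_of_lt_right one_pos, fun t w ht hw hT => ?_⟩
  have hw0 : 0 < w := hx₀.trans_lt hw
  obtain ⟨q, hqc, hq0, hqd, hqf⟩ := hden w hw t ht
  have hpq : p t = q := eq_of_withDensity_ofReal_eq (hpc t ht) hqc (hp0 t ht) hq0
    ((hpd t ht).symm.trans hqd)
  rw [hpq]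
  refine (abs_density_mul_sub_one_le (D := 8 * D) (Ψ := Ψ w) hw0 hκ hβ (min_le_right _ _)
    (hfpos w hw0) ht ((le_max_right _ _).trans hT.le) ?_
    (fun u => hdecay w u hw _ (hΨ w u hw0.le)) (fun u => ?_) ?_).trans
    (hM _ ((le_max_left _ _).trans hT.le)).le
  · have := hL.continuous_integral_cexp hpos hw0.le t
    simpa only [hΨ w _ hw0.le] using this
  · refine (hL.norm_exponent_sub_taylor_le hpos hw0 (hΨ w u hw0.le)).trans ?_
    calc 8 / w * |u| ^ 3 * f (w / 2) ≤ 8 / w * |u| ^ 3 * (D * f w) := by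
          gcongr; exact hhalf w hw
      _ = _ := by ring
  · rw [hqf]
    simp only [hΨ w _ hw0.le]
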